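/- Let $\bar A\in\{0,*\}^{n\times n}$, $\bar b\in\{0,*\}^{n\times 1}$ and $\bar F\in\{0,*\}^{n\times(n+1)}$ be structured matrices ($0$: fixed zero, $*$: free entry); a realization of a structured matrix is a complex matrix that vanishes at all its $0$ entries. A pair $(A,b)$ is controllable if $[b,Ab,\dots,A^{n-1}b]$ has rank $n$. $(\bar A,\bar b)$ is structurally controllable if some realization is controllable. A pair $(A,b)$ is PTC with respect to $\bar F$ if $(A+\Delta A,b+\Delta b)$ is controllable for every realization $[\Delta A,\Delta b]$ of $\bar F$. $(\bar A,\bar b)$ is PTSC with respect to $\bar F$ if almost all controllable realizations (Lebesgue measure on the complex space of the values of the free entries of $[\bar A,\bar b]$) are PTC with respect to $\bar F$, and PSSC with respect to $\bar F$ if it is structurally controllable but not PTSC. **Graphs.** The system graph $\mathcal G$ has vertices $x_1,\dots,x_{n+1}$ and an edge $(x_u,x_k)$, $1\le k\le n$, whenever $[\bar A,\bar b]_{ku}=*$. The auxiliary graph $\tilde{\mathcal G}$ has vertices $x_k^{\mathrm i},x_k^{\mathrm o}$ ($1\le k\le n+1$), an edge $(x_u^{\mathrm o},x_k^{\mathrm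 i})$ for each edge $(x_u,x_k)$ of $\mathcal G$, and the $\lambda$-edges $(x_k^{\mathrm o},x_k^{\mathrm i})$ ($1\le k\le n$; no parallel edges). A self-loop is a $\lambda$-edge $(x_k^{\mathrm o},x_k^{\mathrm i})$ with $\bar A_{kk}=*$. $\mathcal E^{\mathrm{out}}_x$ and $\mathcal E^{\mathrm{in}}_x$ are the sets of edges out of and into $x$. A path family is a set of vertex-disjoint elementary paths; a path-cycle family is a set of vertex-disjoint elementary paths and elementary cycles; its size is its number of edges. Fix $1\le i\le n$, $1\le j\le n+1$. For a path family $\mathcal M$ of size $n$ in $\tilde{\mathcal G}-\mathcal E^{\mathrm{out}}_{x_j^{\mathrm o}}$, let $\tilde{\mathcal G}_{\mathcal M}$ be obtained from $\tilde{\mathcal G}$ by deleting the vertices $x_{n+1}^{\mathrm i},x_j^{\mathrm o}$ and adding the reversal of each edge of $\mathcal M$. Let $\tilde{\mathcal V}_1,\dots,\tilde{\mathcal V}_d$ be the vertex sets of the strongly connected components of $\tilde{\mathcal G}_{\mathcal M}$, let $\tilde{\mathcal G}_k$ be the subgraph of $\tilde{\mathcal G}$ induced by $\tilde{\mathcal V}_k$,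 and let $\tilde{\mathcal V}_k^+=\{x_l^{\mathrm o}: x_l^{\mathrm o}\in\tilde{\mathcal V}_k\}$. Let $\tilde\Omega_j$ be the set of those $k$ for which $\tilde{\mathcal G}_k$ contains a self-loop, or the maximum and the minimum number of $\lambda$-edges over all maximum matchings of $\tilde{\mathcal G}_k$ differ. **Theorem.** Suppose that $(\bar A,\bar b)$ is structurally controllable and that $\bar F$ has exactly one $*$ entry, at position $(i,j)$. Then a path family of size $n$ in $\tilde{\mathcal G}-\mathcal E^{\mathrm{out}}_{x_j^{\mathrm o}}$ exists, and for every such path family $\mathcal M$ (used to define $\tilde{\mathcal G}_k$ and $\tilde\Omega_j$), $(\bar A,\bar b)$ is PSSC with respect to $\bar F$ if and only if at least one of the following holds: (a) the maximum size of a path-cycle family in $\mathcal G-\mathcal E^{\mathrm{out}}_{x_j}$ and the maximum size of a path-cycle family in $\mathcal G-(\mathcal E^{\mathrm{out}}_{x_j}\cup\mathcal E^{\mathrm{in}}_{x_i})$ are both equal to $n-1$; (b) there are a path family $\tilde{\mathcal M}$ of size $n-1$ in $\tilde{\mathcal G}-(\mathcal E^{\mathrm{out}}_{x_j^{\mathrm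 o}}\cup\mathcal E^{\mathrm{in}}_{x_i^{\mathrm i}})$ and a $k\in\tilde\Omega_j$ such that $\tilde{\mathcal M}$ contains at most $|\tilde{\mathcal V}_k^+|-1$ edges of $\tilde{\mathcal G}_k$. -/

import Mathlib

open MeasureTheory

noncomputable section

namespace StructControl

/-! ### Structured matrices and linear systems -/

/-- A structured matrix: the entry `true` stands for `*` (indeterminate) and `false` for `0`
(fixed zero). -/
abbrev StructuredMatrix (p q : Type) : Type := Matrix p q Bool

/-- The set of (complex) realizations of a structured matrix. -/
def Realizations {p q : Type} (S : StructuredMatrix p q) : Set (Matrix p q ℂ) :=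
  {M | ∀ i j, S i j = false → M i j = 0}

/-- The positions of the indeterminate entries; `FreeEntry S → ℂ` is the parameter space of `S`. -/
abbrev FreeEntry {p q : Type} (S : StructuredMatrix p q) : Type :=
  {e : p × q // S e.1 e.2 = true}

/-- The realization of `S` with parameter values `t` at its indeterminate entries. -/
def realize {p q : Type} (S : StructuredMatrix p q) (t : FreeEntry S → ℂ) : Matrix p q ℂ :=
  fun i j => if h : S i j = true then t ⟨(i, j), h⟩ else 0

/-- The composite `[A, B]`; its columns (and the vertices of the system graph) are indexed by
`Fin n ⊕ Fin m`, the `n` states followed by the `m` inputs. -/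
abbrev hcat {n m : ℕ} {R : Type} (A : Matrix (Fin n) (Fin n) R) (B : Matrix (Fin n) (Fin m) R) :
    Matrix (Fin n) (Fin n ⊕ Fin m) R :=
  Matrix.fromCols A B

/-- The controllability matrix `[B, A B, …, A ^ (n - 1) B]`. -/
def controllabilityMatrix {n m : ℕ} (A : Matrix (Fin n) (Fin n) ℂ) (B : Matrix (Fin n) (Fin m) ℂ) :
    Matrix (Fin n) (Fin n × Fin m) ℂ :=
  fun i c => (A ^ (c.1 : ℕ) * B) i c.2

/-- The system with composite matrix `M = [A, B]` is controllable: the controllability matrix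
has full row rank. -/
def Controllable {n m : ℕ} (M : Matrix (Fin n) (Fin n ⊕ Fin m) ℂ) : Prop :=
  (controllabilityMatrix M.toCols₁ M.toCols₂).rank = n

/-- Some realization of the structured pair is controllable. -/
def StructurallyControllable {n m : ℕ} (A : StructuredMatrix (Fin n) (Fin n))
    (B : StructuredMatrix (Fin n) (Fin m)) : Prop :=
  ∃ M ∈ Realizations (hcat A B), Controllable M

/-- Perturbation-tolerant controllability of the system `M = [A, B]`: all perturbed systems
`M + D`, `D` a realization of `F`, are controllable. -/
def PTC {n m : ℕ} (M : Matrix (Fin n) (Fin n ⊕ Fin m) ℂ)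
    (F : StructuredMatrix (Fin n) (Fin n ⊕ Fin m)) : Prop :=
  ∀ D ∈ Realizations F, Controllable (M + D)

/-- Perturbation-tolerant structural controllability: almost all (with respect to Lebesgue measure
on the parameter space) controllable realizations are PTC. -/
def PTSC {n m : ℕ} (A : StructuredMatrix (Fin n) (Fin n)) (B : StructuredMatrix (Fin n) (Fin m))
    (F : StructuredMatrix (Fin n) (Fin n ⊕ Fin m)) : Prop :=
  ∀ᵐ t : FreeEntry (hcat A B) → ℂ,
    Controllable (realize (hcat A B) t) → PTC (realize (hcat A B) t) F

/-- Perturbation-sensitive structural controllability. -/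
def PSSC {n m : ℕ} (A : StructuredMatrix (Fin n) (Fin n)) (B : StructuredMatrix (Fin n) (Fin m))
    (F : StructuredMatrix (Fin n) (Fin n ⊕ Fin m)) : Prop :=
  StructurallyControllable A B ∧ ¬ PTSC A B F

/-! ### Directed graphs, path families and path-cycle families -/

section Graphs

variable {V : Type}

/-- The set of edges out of `x`. -/
def outEdges (G : Digraph V) (x : V) : Set (V × V) := {e | G.Adj e.1 e.2 ∧ e.1 = x}

/-- The set of edges into `x`. -/
def inEdges (G : Digraph V) (x : V) : Set (V × V) := {e | G.Adj e.1 e.2 ∧ e.2 = x}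

/-- The graph `G - E`. -/
def deleteEdges (G : Digraph V) (E : Set (V × V)) : Digraph V where
  Adj u v := G.Adj u v ∧ (u, v) ∉ E

/-- Edges `(v₀, v₁), …, (v_{r-1}, v_r)` traversed by the vertex sequence `v₀, …, v_r`. -/
def pathEdges (l : List V) : List (V × V) := l.zip l.tail

/-- Edges `(v₀, v₁), …, (v_{r-1}, v_r), (v_r, v₀)` of the closed sequence through `v₀, …, v_r`
(a self-loop if `r = 0`). -/
def cycleEdges (l : List V) : List (V × V) := l.zip (l.rotate 1)

/-- The vertex sequence `l` is an elementary path of `G` (a single vertex is the path without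
edges). -/
def IsElementaryPath (G : Digraph V) (l : List V) : Prop :=
  l ≠ [] ∧ l.Nodup ∧ ∀ e ∈ pathEdges l, G.Adj e.1 e.2

/-- The vertex sequence `l` runs once through an elementary cycle of `G`. -/
def IsElementaryCycle (G : Digraph V) (l : List V) : Prop :=
  l ≠ [] ∧ l.Nodup ∧ ∀ e ∈ cycleEdges l, G.Adj e.1 e.2

/-- `E` is the edge set of a path family: a number of vertex-disjoint elementary paths. The size
of the family is `E.ncard`. -/
def IsPathFamily (G : Digraph V) (E : Set (V × V)) : Prop :=
  ∃ P : List (List V), (∀ l ∈ P, IsElementaryPath G l) ∧ P.Pairwise List.Disjoint ∧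
    E = {e | ∃ l ∈ P, e ∈ pathEdges l}

/-- `E` is the edge set of a path-cycle family: a number of elementary paths and elementary cycles,
all of them vertex-disjoint. The size of the family is `E.ncard`. -/
def IsPathCycleFamily (G : Digraph V) (E : Set (V × V)) : Prop :=
  ∃ P C : List (List V), (∀ l ∈ P, IsElementaryPath G l) ∧ (∀ l ∈ C, IsElementaryCycle G l) ∧
    (P ++ C).Pairwise List.Disjoint ∧
    E = {e | (∃ l ∈ P, e ∈ pathEdges l) ∨ ∃ l ∈ C, e ∈ cycleEdges l}

/-- `s` is the maximum size over all path-cycle families of `G`. -/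
def IsMaxPathCycleFamilySize (G : Digraph V) (s : ℕ) : Prop :=
  IsGreatest {k | ∃ E, IsPathCycleFamily G E ∧ E.ncard = k} s

/-- `C` is the vertex set of a strongly connected component of `G`. -/
def IsSCC (G : Digraph V) (C : Set V) : Prop :=
  ∃ v, C = {w | Relation.ReflTransGen G.Adj v w ∧ Relation.ReflTransGen G.Adj w v}

/-- The edges of the subgraph of `G` induced by the vertex set `C`. -/
def inducedEdges (G : Digraph V) (C : Set V) : Set (V × V) :=
  {e | G.Adj e.1 e.2 ∧ e.1 ∈ C ∧ e.2 ∈ C}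

/-- `N` is a matching contained in the edge set `E`. -/
def IsMatching (E N : Set (V × V)) : Prop :=
  N ⊆ E ∧ ∀ e ∈ N, ∀ f ∈ N, e ≠ f → e.1 ≠ f.1 ∧ e.1 ≠ f.2 ∧ e.2 ≠ f.1 ∧ e.2 ≠ f.2

/-- `N` is a maximum matching contained in the edge set `E`. -/
def IsMaximumMatching (E N : Set (V × V)) : Prop :=
  IsMatching E N ∧ ∀ N', IsMatching E N' → N'.ncard ≤ N.ncard

end Graphs

/-! ### The system graph and the auxiliary split graph -/

/-- The system graph: an edge from vertex `u` (state or input) to the state vertex `k` whenever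
the entry of `[A, B]` in row `k` and column `u` is `*`. -/
def systemGraph {n m : ℕ} (A : StructuredMatrix (Fin n) (Fin n))
    (B : StructuredMatrix (Fin n) (Fin m)) : Digraph (Fin n ⊕ Fin m) where
  Adj u v := ∃ k : Fin n, v = Sum.inl k ∧ hcat A B k u = true

/-- The vertex `xⁱ`, which receives the ingoing edges of `x`. -/
abbrev inCopy {V : Type} (x : V) : V ⊕ V := Sum.inl x

/-- The vertex `xᵒ`, which sends the outgoing edges of `x`. -/
abbrev outCopy {V : Type} (x : V) : V ⊕ V := Sum.inr x

/-- `e` is one of the edges `(x_kᵒ, x_kⁱ)`, `k` a state. -/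
def IsLambdaEdge {n m : ℕ}
    (e : ((Fin n ⊕ Fin m) ⊕ (Fin n ⊕ Fin m)) × ((Fin n ⊕ Fin m) ⊕ (Fin n ⊕ Fin m))) : Prop :=
  ∃ k : Fin n, e = (outCopy (Sum.inl k), inCopy (Sum.inl k))

/-- The auxiliary graph: an edge `(uᵒ, vⁱ)` for each edge `(u, v)` of the system graph, and all
the `λ`-edges. -/
def splitGraph {n m : ℕ} (A : StructuredMatrix (Fin n) (Fin n))
    (B : StructuredMatrix (Fin n) (Fin m)) : Digraph ((Fin n ⊕ Fin m) ⊕ (Fin n ⊕ Fin m)) where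
  Adj a c := (∃ u v, a = outCopy u ∧ c = inCopy v ∧ (systemGraph A B).Adj u v) ∨ IsLambdaEdge (a, c)

/-- Vertices of the split graph of a single-input system other than `x_{n+1}ⁱ` and `x_jᵒ`. -/
abbrev ReducedVertex {n : ℕ} (j : Fin n ⊕ Fin 1) : Type :=
  {a : (Fin n ⊕ Fin 1) ⊕ (Fin n ⊕ Fin 1) // a ≠ inCopy (Sum.inr 0) ∧ a ≠ outCopy j}

/-- The split graph with `x_{n+1}ⁱ` and `x_jᵒ` deleted and the reversals of the edges in `M`
added. -/
def residualGraph {n : ℕ} (A : StructuredMatrix (Fin n) (Fin n))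
    (b : StructuredMatrix (Fin n) (Fin 1)) (j : Fin n ⊕ Fin 1)
    (M : Set (((Fin n ⊕ Fin 1) ⊕ (Fin n ⊕ Fin 1)) × ((Fin n ⊕ Fin 1) ⊕ (Fin n ⊕ Fin 1)))) :
    Digraph (ReducedVertex j) where
  Adj a c := (splitGraph A b).Adj a.1 c.1 ∨ (c.1, a.1) ∈ M

/-- `C` is (the vertex set of) one of the strongly connected components of the residual graph,
regarded as a set of vertices of the split graph. -/
def IsComponent {n : ℕ} (A : StructuredMatrix (Fin n) (Fin n))
    (b : StructuredMatrix (Fin n) (Fin 1)) (j : Fin n ⊕ Fin 1)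
    (M : Set (((Fin n ⊕ Fin 1) ⊕ (Fin n ⊕ Fin 1)) × ((Fin n ⊕ Fin 1) ⊕ (Fin n ⊕ Fin 1))))
    (C : Set ((Fin n ⊕ Fin 1) ⊕ (Fin n ⊕ Fin 1))) : Prop :=
  ∃ K : Set (ReducedVertex j), IsSCC (residualGraph A b j M) K ∧ C = Subtype.val '' K

/-- The numbers of `λ`-edges in the maximum matchings of the subgraph of the split graph induced
by `C`. -/
def lambdaCounts {n m : ℕ} (A : StructuredMatrix (Fin n) (Fin n))
    (B : StructuredMatrix (Fin n) (Fin m)) (C : Set ((Fin n ⊕ Fin m) ⊕ (Fin n ⊕ Fin m))) : Set ℕ :=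
  {k | ∃ N, IsMaximumMatching (inducedEdges (splitGraph A B) C) N ∧
    {e | e ∈ N ∧ IsLambdaEdge e}.ncard = k}

/-- The maximum number of `λ`-edges in a maximum matching. -/
def gammaMax {n m : ℕ} (A : StructuredMatrix (Fin n) (Fin n))
    (B : StructuredMatrix (Fin n) (Fin m)) (C : Set ((Fin n ⊕ Fin m) ⊕ (Fin n ⊕ Fin m))) : ℕ :=
  sSup (lambdaCounts A B C)

/-- The minimum number of `λ`-edges in a maximum matching. -/
def gammaMin {n m : ℕ} (A : StructuredMatrix (Fin n) (Fin n))
    (B : StructuredMatrix (Fin n) (Fin m)) (C : Set ((Fin n ⊕ Fin m) ⊕ (Fin n ⊕ Fin m))) : ℕ :=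
  sInf (lambdaCounts A B C)

/-- The subgraph of the split graph induced by `C` contains a self-loop, that is, a `λ`-edge
`(x_kᵒ, x_kⁱ)` with `A_kk = *`. -/
def HasSelfLoop {n m : ℕ} (A : StructuredMatrix (Fin n) (Fin n))
    (B : StructuredMatrix (Fin n) (Fin m)) (C : Set ((Fin n ⊕ Fin m) ⊕ (Fin n ⊕ Fin m))) : Prop :=
  ∃ k : Fin n, (outCopy (Sum.inl k), inCopy (Sum.inl k)) ∈ inducedEdges (splitGraph A B) C ∧
    A k k = true

/-- `γ_nz = 1` for the subgraph of the split graph induced by `C`. -/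
def GammaNz {n m : ℕ} (A : StructuredMatrix (Fin n) (Fin n))
    (B : StructuredMatrix (Fin n) (Fin m)) (C : Set ((Fin n ⊕ Fin m) ⊕ (Fin n ⊕ Fin m))) : Prop :=
  gammaMin A B C < gammaMax A B C ∨ HasSelfLoop A B C

end StructControl

end

open StructControl

/-! By the Popov–Belevitch–Hautus test (`controllable_iff_pbh`), changing the single entry `(i, j)`
can spoil a controllable realization exactly when, for some complex `c`, the square matrix `Q(c)`
obtained from `[A - cI, b]` by dropping column `j` has a left null vector `w` with `w i ≠ 0`: the
entry can then be tuned so that `w` kills column `j` as well (`not_ptc_iff`). Almost all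
realizations are controllable (`ae_controllable`), so the question is whether such a pair `(c, w)`
exists on a set of parameters of positive measure.

A path family of size `n` is a transversal `τ` matching the rows with the columns other than `j`.
Identifying row `r` with column `τ r` turns the pattern of `Q(c)` into a digraph `Step` on the rows.
Its strong classes are the components of the residual graph (`isComponent_iff`), and the maximum
matchings of a component are the permutations of its class along `Step`. If `GammaNz` fails for a
class, all these permutations meet equally many `λ`-entries, none of them free, so the determinant
of the block is a power of `c` times a generically nonzero factor (`det_diagBlock_eq`,
`ae_det_diagBlock_ne_zero`). Condition (b) says that a class with `GammaNz` is reachable from `i`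
(`exists_deficient_pathFamily_iff`). Condition (a) says that `Q(0)` has no full matching, but has
one once row `i` is removed (`maxPathCycle_iff`).

Necessity (`ptsc_of_not`): a null vector at `c = 0` forces (a), generically. A null vector at `c ≠
0` makes the block of some class reachable from `i` singular, which generically forces (b).

Sufficiency: under (a), a row of the adjugate of `Q(0)` is a null vector with nonzero `i`-th entry
on an open set (`not_ptsc_of_rank_deficient`). Under (b), restrict to the rows that reach the given
class. A column-scaled weighted Laplacian gives a realization singular at `c = 1`, with the required
cofactor nonzero and with determinant not identically zero in `c` (`exists_singular_realization`).
Zeros of analytic functions persist under perturbation (`eventually_exists_zero`), so again an open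
set is bad (`not_ptsc_of_gammaNz`). -/

namespace StructControl

/-! ### Generic nonvanishing of polynomials. -/

/-- `f` is a polynomial function of its coordinates. -/
def IsPoly {ι : Type} (f : (ι → ℂ) → ℂ) : Prop :=
  ∃ p : MvPolynomial ι ℂ, ∀ t, f t = MvPolynomial.eval t p

namespace IsPoly

variable {ι : Type} {f g : (ι → ℂ) → ℂ}

theorem const (c : ℂ) : IsPoly (fun _ : ι → ℂ => c) := ⟨MvPolynomial.C c, by simp⟩

theorem coord (e : ι) : IsPoly (fun t : ι → ℂ => t e) := ⟨MvPolynomial.X e, by simp⟩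

theorem add (hf : IsPoly f) (hg : IsPoly g) : IsPoly (fun t => f t + g t) := by
  obtain ⟨p, hp⟩ := hf
  obtain ⟨q, hq⟩ := hg
  exact ⟨p + q, by simp [hp, hq]⟩

theorem mul (hf : IsPoly f) (hg : IsPoly g) : IsPoly (fun t => f t * g t) := by
  obtain ⟨p, hp⟩ := hf
  obtain ⟨q, hq⟩ := hg
  exact ⟨p * q, by simp [hp, hq]⟩

theorem sum {κ : Type} (s : Finset κ) {F : κ → (ι → ℂ) → ℂ} (h : ∀ k, IsPoly (F k)) :
    IsPoly (fun t => ∑ k ∈ s, F k t) := by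
  choose p hp using h
  exact ⟨∑ k ∈ s, p k, by simp [hp]⟩

theorem prod {κ : Type} (s : Finset κ) {F : κ → (ι → ℂ) → ℂ} (h : ∀ k, IsPoly (F k)) :
    IsPoly (fun t => ∏ k ∈ s, F k t) := by
  choose p hp using h
  exact ⟨∏ k ∈ s, p k, by simp [hp]⟩

theorem det {κ : Type} [Fintype κ] [DecidableEq κ] {F : (ι → ℂ) → Matrix κ κ ℂ}
    (h : ∀ r s, IsPoly (fun t => F t r s)) : IsPoly (fun t => (F t).det) := by
  simp only [Matrix.det_apply']
  exact sum _ fun π => (const _).mul (prod _ fun s => h _ _)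

theorem matrix_mul {κ μ ν : Type} [Fintype μ] {F : (ι → ℂ) → Matrix κ μ ℂ}
    {G : (ι → ℂ) → Matrix μ ν ℂ} (hF : ∀ r s, IsPoly (fun t => F t r s))
    (hG : ∀ r s, IsPoly (fun t => G t r s)) (r : κ) (s : ν) :
    IsPoly (fun t => (F t * G t) r s) := by
  simp only [Matrix.mul_apply]
  exact sum _ fun k => (hF _ _).mul (hG _ _)

end IsPoly

/-- Induction with Fubini: view `p` as a polynomial in its first variable. Some coefficient is
nonzero at almost every value of the other variables, and then only finitely many values of the
first variable are roots. -/
theorem ae_eval_ne_zero_fin (n : ℕ) (p : MvPolynomial (Fin n) ℂ) (hp : p ≠ 0) :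
    ∀ᵐ t : Fin n → ℂ, MvPolynomial.eval t p ≠ 0 := by
  induction n with
  | zero =>
    refine Filter.Eventually.of_forall fun t ht => hp ?_
    refine MvPolynomial.funext fun x => ?_
    rw [Subsingleton.elim x t, ht, map_zero]
  | succ n ih =>
    have hne : MvPolynomial.finSuccEquiv ℂ n p ≠ 0 := by
      simpa using hp
    obtain ⟨k, hk⟩ : ∃ k, (MvPolynomial.finSuccEquiv ℂ n p).coeff k ≠ 0 := by
      by_contra! h
      exact hne (Polynomial.ext (by simpa using h))
    have key := ih _ hk
    have hmp := (volume_preserving_piFinSuccAbove (fun _ : Fin (n + 1) => ℂ) 0).symm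
    have hms : MeasurableSet {t : Fin (n + 1) → ℂ | MvPolynomial.eval t p ≠ 0} :=
      (MeasurableSet.singleton 0).compl.preimage (MvPolynomial.continuous_eval p).measurable
    rw [← hmp.map_eq, ae_map_iff (MeasurableEquiv.measurable _).aemeasurable hms,
      Measure.volume_eq_prod]
    have hmeas : MeasurableSet {x : ℂ × (Fin n → ℂ) | MvPolynomial.eval
        ((MeasurableEquiv.piFinSuccAbove (fun _ : Fin (n + 1) => ℂ) 0).symm (x.1, x.2)) p ≠ 0} :=
      hms.preimage (MeasurableEquiv.measurable _)
    refine (Measure.ae_prod_iff_ae_ae hmeas).2 ((Measure.ae_ae_comm hmeas).2 ?_)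
    filter_upwards [key] with s hs
    have hq : Polynomial.map (MvPolynomial.eval s) (MvPolynomial.finSuccEquiv ℂ n p) ≠ 0 := by
      intro h0
      apply hs
      simpa using congrArg (fun q => Polynomial.coeff q k) h0
    refine measure_mono_null ?_ ((Polynomial.map (MvPolynomial.eval s)
      (MvPolynomial.finSuccEquiv ℂ n p)).roots.toFinset.finite_toSet.measure_zero volume)
    intro y hy
    have hy0 : MvPolynomial.eval (Fin.cons y s : Fin (n + 1) → ℂ) p = 0 := by
      simpa [MeasurableEquiv.piFinSuccAbove, Fin.insertNthEquiv] using hy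
    rw [MvPolynomial.eval_eq_eval_mv_eval'] at hy0
    simpa [hq] using hy0

/-- The form in which genericity is used throughout: exhibiting one parameter with nonzero value
suffices. The parameters are reindexed by `Fin` through a measure-preserving map. -/
theorem IsPoly.ae_ne_zero {ι : Type} [Fintype ι] {f : (ι → ℂ) → ℂ} (hf : IsPoly f) {t₁ : ι → ℂ}
    (h : f t₁ ≠ 0) : ∀ᵐ t : ι → ℂ, f t ≠ 0 := by
  obtain ⟨p, hp⟩ := hf
  let e := Fintype.equivFin ι
  have hne : MvPolynomial.rename e p ≠ 0 := by
    intro h0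
    have : p = 0 := by simpa using MvPolynomial.rename_injective e e.injective (h0.trans (map_zero _).symm)
    exact h (by rw [hp, this, map_zero])
  have h1 := ae_eval_ne_zero_fin _ _ hne
  have hmp := volume_measurePreserving_piCongrLeft (fun _ : ι => ℂ) e.symm
  have h2 : ∀ᵐ t : ι → ℂ, MvPolynomial.eval t p ≠ 0 := by
    have hms : MeasurableSet {t : ι → ℂ | MvPolynomial.eval t p ≠ 0} :=
      (MeasurableSet.singleton 0).compl.preimage (MvPolynomial.continuous_eval p).measurable
    rw [← hmp.map_eq, ae_map_iff (MeasurableEquiv.measurable _).aemeasurable hms]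
    filter_upwards [h1] with t ht
    rw [MvPolynomial.eval_rename] at ht
    convert ht using 3
    ext i
    simp [MeasurableEquiv.coe_piCongrLeft, Equiv.piCongrLeft_apply]
  filter_upwards [h2] with t ht
  rwa [hp]

end StructControl

/-! ### Controllability: determinant form and eigenvector test. -/

namespace StructControl
open scoped Matrix

theorem controllable_iff_det {n : ℕ} (M : Matrix (Fin n) (Fin n ⊕ Fin 1) ℂ) :
    Controllable M ↔
      (Matrix.of fun r k : Fin n => (M.toCols₁ ^ (k : ℕ) * M.toCols₂) r 0).det ≠ 0 := by
  unfold Controllable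
  have h : Matrix.of (fun r k : Fin n => (M.toCols₁ ^ (k : ℕ) * M.toCols₂) r 0) =
      (controllabilityMatrix M.toCols₁ M.toCols₂).submatrix id
        (Equiv.prodUnique (Fin n) (Fin 1)).symm := by
    ext r k
    simp [controllabilityMatrix]
  have hr := Matrix.rank_submatrix (controllabilityMatrix M.toCols₁ M.toCols₂) (Equiv.refl _)
    (Equiv.prodUnique (Fin n) (Fin 1)).symm
  have h2 : (controllabilityMatrix M.toCols₁ M.toCols₂).rank =
      (Matrix.of (fun r k : Fin n => (M.toCols₁ ^ (k : ℕ) * M.toCols₂) r 0)).rank := by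
    rw [h]; exact hr.symm
  rw [h2, ← isUnit_iff_ne_zero, ← Matrix.isUnit_iff_isUnit_det]
  constructor
  · intro h3
    rw [← Matrix.mulVec_surjective_iff_isUnit]
    exact LinearMap.range_eq_top.1 (Submodule.eq_top_of_finrank_eq (h3.trans (by simp)))
  · intro h3
    simpa using Matrix.rank_of_isUnit _ h3

/-- The Popov–Belevitch–Hautus test. -/
theorem controllable_iff_pbh {n : ℕ} (M : Matrix (Fin n) (Fin n ⊕ Fin 1) ℂ) :
    Controllable M ↔ ∀ (c : ℂ) (w : Fin n → ℂ),
      (∀ u, ∑ r, w r * (M r u - if u = Sum.inl r then c else 0) = 0) → w = 0 := by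
  rw [controllable_iff_det, Ne, ← Matrix.exists_vecMul_eq_zero_iff]
  constructor
  · intro h c w hw
    by_contra hne
    refine h ⟨w, hne, ?_⟩
    have hA : w ᵥ* M.toCols₁ = c • w := by
      ext s
      have := hw (Sum.inl s)
      simp only [mul_sub, Finset.sum_sub_distrib, Sum.inl.injEq, mul_ite, mul_zero,
        Finset.sum_ite_eq, Finset.mem_univ, if_true] at this
      simp [Matrix.vecMul, dotProduct, Matrix.toCols₁_apply]
      linear_combination this
    have hb : w ᵥ* M.toCols₂ = 0 := by
      ext s
      have := hw (Sum.inr s)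
      simpa [Matrix.vecMul, dotProduct] using this
    have hk : ∀ k : ℕ, w ᵥ* M.toCols₁ ^ k = c ^ k • w := by
      intro k
      induction k with
      | zero => simp
      | succ k ih => rw [pow_succ, ← Matrix.vecMul_vecMul, ih, Matrix.smul_vecMul, hA, smul_smul,
          pow_succ]
    ext k
    have : (w ᵥ* (M.toCols₁ ^ (k : ℕ) * M.toCols₂)) 0 = 0 := by
      rw [← Matrix.vecMul_vecMul, hk, Matrix.smul_vecMul, hb]; simp
    simpa [Matrix.vecMul, dotProduct] using this
  · rintro h ⟨w, hne, hw⟩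
    let T : Module.End ℂ (Fin n → ℂ) := Matrix.vecMulLinear M.toCols₁
    -- The left vectors annihilated by every `A ^ k * b` form an invariant subspace; an eigenvector
    -- inside it violates the test.
    let W : Submodule ℂ (Fin n → ℂ) :=
      { carrier := {x | ∀ k : ℕ, (x ᵥ* (M.toCols₁ ^ k)) ᵥ* M.toCols₂ = 0}
        add_mem' := fun {x y} hx hy k => by rw [Matrix.add_vecMul, Matrix.add_vecMul, hx, hy, add_zero]
        zero_mem' := fun k => by simp
        smul_mem' := fun a x hx k => by rw [Matrix.smul_vecMul, Matrix.smul_vecMul, hx, smul_zero] }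
    have hwW : w ∈ W := by
      have hn : 0 < n := by
        rcases Nat.eq_zero_or_pos n with h0 | h0
        · subst h0; exact absurd (Subsingleton.elim _ _) hne
        · exact h0
      intro k
      -- Cayley–Hamilton: powers `k ≥ n` reduce to the powers below `n`, which are all that `hw`
      -- covers.
      rw [Matrix.pow_eq_aeval_mod_charpoly]
      have hdeg : (Polynomial.X ^ k %ₘ M.toCols₁.charpoly).natDegree < n := by
        have := Polynomial.natDegree_modByMonic_lt (Polynomial.X ^ k) M.toCols₁.charpoly_monic
          (fun h1 => by
            have := M.toCols₁.charpoly_natDegree_eq_dim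
            rw [h1] at this
            simp at this
            omega)
        simpa using this
      rw [Polynomial.aeval_eq_sum_range' hdeg, Matrix.vecMul_vecMul, Matrix.sum_mul]
      have hl : ∀ l : ℕ, l < n → w ᵥ* (M.toCols₁ ^ l * M.toCols₂) = 0 := by
        intro l hl
        ext u
        have := congrFun hw ⟨l, hl⟩
        rw [Subsingleton.elim u 0]
        simpa [Matrix.vecMul, dotProduct] using this
      rw [Matrix.vecMul_sum]
      refine Finset.sum_eq_zero fun l hlm => ?_
      rw [Matrix.smul_mul, Matrix.vecMul_smul, hl l (Finset.mem_range.1 hlm), smul_zero]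
    have hmaps : ∀ x ∈ W, T x ∈ W := by
      intro x hx k
      have := hx (k + 1)
      rwa [pow_succ', ← Matrix.vecMul_vecMul] at this
    have : Nontrivial W := ⟨⟨⟨w, hwW⟩, 0, fun h => hne (by simpa using congrArg Subtype.val h)⟩⟩
    obtain ⟨c, hc⟩ := Module.End.exists_eigenvalue (T.restrict hmaps)
    obtain ⟨x, hx⟩ := hc.exists_hasEigenvector
    have hx0 : (x : Fin n → ℂ) ≠ 0 := fun h => hx.2 (Subtype.ext h)
    have hxe : (x : Fin n → ℂ) ᵥ* M.toCols₁ = c • (x : Fin n → ℂ) :=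
      congrArg Subtype.val hx.apply_eq_smul
    refine hx0 (h c x fun u => ?_)
    rcases u with s | s
    · have := congrFun hxe s
      simp only [mul_sub, Finset.sum_sub_distrib, Sum.inl.injEq, mul_ite, mul_zero,
        Finset.sum_ite_eq, Finset.mem_univ, if_true]
      simp [Matrix.vecMul, dotProduct, Matrix.toCols₁_apply] at this
      linear_combination this
    · have := congrFun (x.2 0) s
      rw [pow_zero, Matrix.vecMul_one] at this
      simpa [Matrix.vecMul, dotProduct] using this

end StructControl

/-! ### Path and path-cycle families as edge sets with distinct tails and heads. -/

namespace StructControl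

section Families

variable {V : Type}

theorem pathEdges_append (a b : List V) (u v : V) :
    pathEdges (a ++ u :: v :: b) = pathEdges (a ++ [u]) ++ (u, v) :: pathEdges (v :: b) := by
  induction a with
  | nil => simp [pathEdges]
  | cons x a ih =>
    cases a with
    | nil => simp [pathEdges]
    | cons y a =>
      have h : ∀ l : List V, pathEdges (x :: y :: l) = (x, y) :: pathEdges (y :: l) := fun l => by
        simp [pathEdges]
      simp only [List.cons_append] at ih ⊢
      rw [h, h, ih, List.cons_append]

theorem cycleEdges_cons (v : V) (b : List V) :
    cycleEdges (v :: b) = pathEdges (v :: b ++ [v]) := by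
  have h : ∀ (l m : List V) (x : V), m.length = l.length → l.zip m = (l ++ [x]).zip m := by
    intro l
    induction l with
    | nil => intro m x hm; simp at hm; simp [hm]
    | cons y l ih =>
      intro m x hm
      cases m with
      | nil => simp at hm
      | cons z m => simp only [List.cons_append, List.zip_cons_cons]; rw [← ih m x (by simpa using hm)]
  simp only [cycleEdges, pathEdges, List.rotate_cons_succ, List.rotate_zero, List.cons_append,
    List.tail_cons]
  rw [← List.cons_append]
  exact h _ _ _ (by simp)

theorem pathEdges_subset_cycleEdges (l : List V) : pathEdges l ⊆ cycleEdges l := by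
  cases l with
  | nil => simp [pathEdges]
  | cons v b =>
    rw [cycleEdges_cons]
    rcases List.eq_nil_or_concat (v :: b) with h | ⟨a, u, h⟩
    · simp at h
    · rw [List.concat_eq_append] at h
      rw [h, List.append_assoc]
      simp only [List.cons_append, List.nil_append]
      rw [pathEdges_append]
      exact List.subset_append_left _ _

theorem mem_of_mem_cycleEdges {l : List V} {e : V × V} (h : e ∈ cycleEdges l) :
    e.1 ∈ l ∧ e.2 ∈ l := by
  have := List.of_mem_zip (a := e.1) (b := e.2) h
  simpa using this

theorem eq_of_mem_zip_fst {l m : List V} (hl : l.Nodup) {e f : V × V} (he : e ∈ l.zip m)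
    (hf : f ∈ l.zip m) (h : e.1 = f.1) : e = f := by
  obtain ⟨a, ha, rfl⟩ := List.mem_iff_getElem.1 he
  obtain ⟨b, hb, rfl⟩ := List.mem_iff_getElem.1 hf
  simp only [List.getElem_zip] at h
  have := (List.Nodup.getElem_inj_iff hl).1 h
  subst this; rfl

theorem eq_of_mem_zip_snd {l m : List V} (hm : m.Nodup) {e f : V × V} (he : e ∈ l.zip m)
    (hf : f ∈ l.zip m) (h : e.2 = f.2) : e = f := by
  obtain ⟨a, ha, rfl⟩ := List.mem_iff_getElem.1 he
  obtain ⟨b, hb, rfl⟩ := List.mem_iff_getElem.1 hf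
  simp only [List.getElem_zip] at h
  have := (List.Nodup.getElem_inj_iff hm).1 h
  subst this; rfl

/-- The edges of `E` are edges of `G` with distinct tails and distinct heads. -/
structure IsLinking (G : Digraph V) (E : Set (V × V)) : Prop where
  adj : ∀ e ∈ E, G.Adj e.1 e.2
  injFst : Set.InjOn Prod.fst E
  injSnd : Set.InjOn Prod.snd E

theorem IsPathFamily.isPathCycleFamily {G : Digraph V} {E : Set (V × V)} (h : IsPathFamily G E) :
    IsPathCycleFamily G E := by
  obtain ⟨P, hP, hd, rfl⟩ := h
  exact ⟨P, [], hP, by simp, by simpa using hd, by simp⟩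

theorem IsPathCycleFamily.isLinking {G : Digraph V} {E : Set (V × V)}
    (h : IsPathCycleFamily G E) : IsLinking G E := by
  obtain ⟨P, C, hP, hC, hd, rfl⟩ := h
  have hmem : ∀ e ∈ {e | (∃ l ∈ P, e ∈ pathEdges l) ∨ ∃ l ∈ C, e ∈ cycleEdges l},
      ∃ l ∈ P ++ C, e ∈ cycleEdges l := by
    rintro e (⟨l, hl, he⟩ | ⟨l, hl, he⟩)
    · exact ⟨l, by simp [hl], pathEdges_subset_cycleEdges l he⟩
    · exact ⟨l, by simp [hl], he⟩
  have hnd : ∀ l ∈ P ++ C, l.Nodup := by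
    intro l hl
    rcases List.mem_append.1 hl with hl | hl
    · exact (hP l hl).2.1
    · exact (hC l hl).2.1
  have huniq : ∀ l ∈ P ++ C, ∀ l' ∈ P ++ C, ∀ x, x ∈ l → x ∈ l' → l = l' := by
    intro l hl l' hl' x hx hx'
    by_contra hne
    have : Std.Symm (List.Disjoint (α := V)) := ⟨fun _ _ h => h.symm⟩
    exact (List.Pairwise.forall hd hl hl' hne) hx hx'
  refine ⟨?_, ?_, ?_⟩
  · rintro e (⟨l, hl, he⟩ | ⟨l, hl, he⟩)
    · exact (hP l hl).2.2 e he
    · exact (hC l hl).2.2 e he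
  · intro e he f hf h
    obtain ⟨l, hl, hel⟩ := hmem e he
    obtain ⟨l', hl', hfl⟩ := hmem f hf
    have := huniq l hl l' hl' e.1 (mem_of_mem_cycleEdges hel).1
      (by rw [show e.1 = f.1 from h]; exact (mem_of_mem_cycleEdges hfl).1)
    subst this
    exact eq_of_mem_zip_fst (hnd l hl) hel hfl h
  · intro e he f hf h
    obtain ⟨l, hl, hel⟩ := hmem e he
    obtain ⟨l', hl', hfl⟩ := hmem f hf
    have := huniq l hl l' hl' e.2 (mem_of_mem_cycleEdges hel).2
      (by rw [show e.2 = f.2 from h]; exact (mem_of_mem_cycleEdges hfl).2)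
    subst this
    exact eq_of_mem_zip_snd (List.nodup_rotate.2 (hnd l hl)) hel hfl h

/-- Insert edges one at a time, keeping isolated vertices as one-vertex paths so that the lists
always cover `V`. For a new edge `(u, v)`, `u` has no outgoing edge yet and so ends a path, while
`v` begins one. If these are the same path it closes to a cycle; otherwise the two paths are joined.
-/
theorem exists_path_cycle_decomposition [Fintype V] {E : Set (V × V)} (hE : E.Finite)
    (h1 : Set.InjOn Prod.fst E) (h2 : Set.InjOn Prod.snd E) :
    ∃ P C : List (List V), (∀ l ∈ P ++ C, l ≠ [] ∧ l.Nodup) ∧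
      (P ++ C).Pairwise List.Disjoint ∧ (∀ x, ∃ l ∈ P ++ C, x ∈ l) ∧
      ∀ e, e ∈ E ↔ (∃ l ∈ P, e ∈ pathEdges l) ∨ ∃ l ∈ C, e ∈ cycleEdges l := by
  classical
  induction E, hE using Set.Finite.induction_on with
  | empty =>
    refine ⟨Finset.univ.toList.map fun x => [x], [], by simp, ?_, by simp, by simp [pathEdges]⟩
    rw [List.append_nil, List.pairwise_map]
    exact (Finset.nodup_toList _).imp (by simp [eq_comm])
  | @insert uv E hnot hE ih =>
    obtain ⟨u, v⟩ := uv
    obtain ⟨P, C, hnd, hd, hsp, hiff⟩ := ih (h1.mono (Set.subset_insert _ _))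
      (h2.mono (Set.subset_insert _ _))
    have hu : ∀ e ∈ E, e.1 ≠ u := fun e he h => hnot <| by
      rwa [← h1 (Set.mem_insert_of_mem _ he) (Set.mem_insert _ _) h]
    have hv : ∀ e ∈ E, e.2 ≠ v := fun e he h => hnot <| by
      rwa [← h2 (Set.mem_insert_of_mem _ he) (Set.mem_insert _ _) h]
    obtain ⟨l, hl, a, rfl⟩ : ∃ l ∈ P, ∃ a, l = a ++ [u] := by
      obtain ⟨l, hl, hul⟩ := hsp u
      rcases List.mem_append.1 hl with hl | hl
      · obtain ⟨a, c, rfl⟩ := List.append_of_mem hul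
        cases c with
        | nil => exact ⟨_, hl, a, rfl⟩
        | cons y c =>
          refine absurd rfl (hu (u, y) ((hiff _).2 (Or.inl ⟨_, hl, ?_⟩)))
          rw [pathEdges_append]; simp
      · have : u ∈ (cycleEdges l).map Prod.fst := by
          rw [cycleEdges, List.map_fst_zip (by simp)]; exact hul
        obtain ⟨e, he, rfl⟩ := List.mem_map.1 this
        exact absurd rfl (hu e ((hiff _).2 (Or.inr ⟨_, hl, he⟩)))
    obtain ⟨m, hm, b, rfl⟩ : ∃ l ∈ P, ∃ b, l = v :: b := by
      obtain ⟨l, hl, hul⟩ := hsp v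
      rcases List.mem_append.1 hl with hl | hl
      · obtain ⟨c, b, rfl⟩ := List.append_of_mem hul
        rcases List.eq_nil_or_concat c with rfl | ⟨c, y, rfl⟩
        · exact ⟨_, hl, b, rfl⟩
        · refine absurd rfl (hv (y, v) ((hiff _).2 (Or.inl ⟨_, hl, ?_⟩)))
          rw [List.concat_eq_append, List.append_assoc, List.singleton_append, pathEdges_append]; simp
      · have : v ∈ (cycleEdges l).map Prod.snd := by
          rw [cycleEdges, List.map_snd_zip (by simp)]; simpa using hul
        obtain ⟨e, he, rfl⟩ := List.mem_map.1 this
        exact absurd rfl (hv e ((hiff _).2 (Or.inr ⟨_, hl, he⟩)))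
    have hsymm : ∀ {x y : List V}, List.Disjoint x y → List.Disjoint y x := fun h => h.symm
    by_cases hlm : a ++ [u] = v :: b
    · have hperm := List.perm_cons_erase hl
      set P' := P.erase (a ++ [u]) with hP'
      have hperm' : (P ++ C).Perm (P' ++ (a ++ [u]) :: C) :=
        (hperm.append_right C).trans List.perm_middle.symm
      have hmem : ∀ x, x ∈ P' ++ (a ++ [u]) :: C ↔ x ∈ P ++ C := fun x => hperm'.mem_iff.symm
      refine ⟨P', (a ++ [u]) :: C, fun x hx => hnd x ((hmem x).1 hx),
        (hperm'.pairwise_iff hsymm).1 hd, fun x => ?_, fun e => ?_⟩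
      · obtain ⟨l, hl, hx⟩ := hsp x
        exact ⟨l, (hmem l).2 hl, hx⟩
      · have hc : cycleEdges (a ++ [u]) = pathEdges (a ++ [u]) ++ [(u, v)] := by
          conv_lhs => rw [hlm]
          rw [cycleEdges_cons, ← hlm, List.append_assoc, List.singleton_append, pathEdges_append]
          simp [pathEdges]
        rw [Set.mem_insert_iff, hiff e]
        simp only [hperm.mem_iff, List.mem_cons, exists_eq_or_imp, hc, List.mem_append,
          List.not_mem_nil, or_false]
        clear * -
        generalize (∃ l ∈ C, e ∈ cycleEdges l) = p1, (∃ a ∈ P', e ∈ pathEdges a) = p2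
        tauto
    · have hperm1 := List.perm_cons_erase hl
      have hm' : (v :: b) ∈ P.erase (a ++ [u]) := (List.mem_erase_of_ne (Ne.symm hlm)).2 hm
      have hperm := hperm1.trans ((List.perm_cons_erase hm').cons _)
      set P' := (P.erase (a ++ [u])).erase (v :: b) with hP'
      have hperm' : (P ++ C).Perm ((a ++ [u]) :: (v :: b) :: (P' ++ C)) := hperm.append_right C
      have hd' := (hperm'.pairwise_iff hsymm).1 hd
      have hmem : ∀ x, x ∈ P ++ C ↔ x = a ++ [u] ∨ x = v :: b ∨ x ∈ P' ++ C := fun x => by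
        rw [hperm'.mem_iff]; simp
      rw [List.pairwise_cons, List.pairwise_cons] at hd'
      refine ⟨(a ++ u :: v :: b) :: P', C, ?_, ?_, fun x => ?_, fun e => ?_⟩
      · intro x hx
        rw [List.cons_append, List.mem_cons] at hx
        rcases hx with rfl | hx
        · refine ⟨by simp, ?_⟩
          have : a ++ u :: v :: b = (a ++ [u]) ++ (v :: b) := by simp
          rw [this]
          exact List.Nodup.append (hnd _ ((hmem _).2 (Or.inl rfl))).2
            (hnd _ ((hmem _).2 (Or.inr (Or.inl rfl)))).2 (hd'.1 _ (by simp))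
        · exact hnd x ((hmem _).2 (Or.inr (Or.inr hx)))
      · rw [List.cons_append, List.pairwise_cons]
        refine ⟨fun x hx => ?_, hd'.2.2⟩
        have e1 := hd'.1 x (List.mem_cons_of_mem _ hx)
        have e2 := hd'.2.1 x hx
        have : a ++ u :: v :: b = (a ++ [u]) ++ (v :: b) := by simp
        rw [this]
        exact List.disjoint_append_left.2 ⟨e1, e2⟩
      · obtain ⟨l, hl, hx⟩ := hsp x
        rcases (hmem l).1 hl with rfl | rfl | hl
        · exact ⟨a ++ u :: v :: b, by simp, by simp at hx ⊢; tauto⟩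
        · exact ⟨a ++ u :: v :: b, by simp, by simp at hx ⊢; tauto⟩
        · exact ⟨l, by simp at hl ⊢; tauto, hx⟩
      · rw [Set.mem_insert_iff, hiff e]
        simp only [hperm.mem_iff, List.mem_cons, exists_eq_or_imp, pathEdges_append,
          List.mem_append]
        clear * -
        generalize (∃ l ∈ C, e ∈ cycleEdges l) = p1, (∃ a ∈ P', e ∈ pathEdges a) = p2
        tauto

theorem IsLinking.isPathCycleFamily [Fintype V] {G : Digraph V} {E : Set (V × V)}
    (h : IsLinking G E) : IsPathCycleFamily G E := by
  obtain ⟨P, C, hnd, hd, -, hiff⟩ :=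
    exists_path_cycle_decomposition (Set.toFinite E) h.injFst h.injSnd
  refine ⟨P, C, fun l hl => ?_, fun l hl => ?_, hd, Set.ext hiff⟩
  · have := hnd l (by simp [hl])
    exact ⟨this.1, this.2, fun e he => h.adj e ((hiff e).2 (Or.inl ⟨l, hl, he⟩))⟩
  · have := hnd l (by simp [hl])
    exact ⟨this.1, this.2, fun e he => h.adj e ((hiff e).2 (Or.inr ⟨l, hl, he⟩))⟩

/-- In a graph whose edges all lead from `S` to its complement, linkings are path families. -/
theorem IsLinking.isPathFamily [Fintype V] {G : Digraph V} {E : Set (V × V)} (S : Set V)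
    (hS : ∀ u v, G.Adj u v → u ∈ S ∧ v ∉ S) (h : IsLinking G E) : IsPathFamily G E := by
  classical
  have hfin := Set.toFinite E
  refine ⟨hfin.toFinset.toList.map fun e => [e.1, e.2], ?_, ?_, ?_⟩
  · intro l hl
    obtain ⟨e, he, rfl⟩ := List.mem_map.1 hl
    have hadj := h.adj e (by simpa using he)
    refine ⟨by simp, ?_, by simpa [pathEdges] using hadj⟩
    have := hS _ _ hadj
    simp only [List.nodup_cons, List.mem_singleton, List.not_mem_nil, not_false_eq_true,
      List.nodup_nil, and_true]
    intro heq
    exact this.2 (heq ▸ this.1)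
  · rw [List.pairwise_map]
    refine List.Pairwise.imp_of_mem ?_ (Finset.nodup_toList _)
    intro e f he hf hne
    replace he : e ∈ E := by simpa using he
    replace hf : f ∈ E := by simpa using hf
    have h1 := hS _ _ (h.adj e he)
    have h2 := hS _ _ (h.adj f hf)
    intro x hx hx'
    simp only [List.mem_cons, List.not_mem_nil, or_false] at hx hx'
    rcases hx with rfl | rfl <;> rcases hx' with hx' | hx'
    · exact hne (h.injFst he hf hx')
    · exact h2.2 (hx' ▸ h1.1)
    · exact h1.2 (hx' ▸ h2.1)
    · exact hne (h.injSnd he hf hx')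
  · ext e
    simp only [List.mem_map, Finset.mem_toList, Set.Finite.mem_toFinset, Set.mem_ofPred_eq]
    constructor
    · intro he
      exact ⟨_, ⟨e, he, rfl⟩, by simp [pathEdges]⟩
    · rintro ⟨l, ⟨f, hf, rfl⟩, he⟩
      simp [pathEdges] at he
      rwa [he]

end Families

end StructControl

/-! ### Closing paths to permutations; existence of a path family of size `n`. -/

namespace StructControl

/-- Loop erasure: if the new head already occurs on the chain, cut the chain back to that
occurrence. -/
theorem exists_nodup_chain {α : Type} {r : α → α → Prop} {a b : α}
    (h : Relation.ReflTransGen r a b) :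
    ∃ l : List α, (a :: l).Nodup ∧ (a :: l).IsChain r ∧ b ∈ (a :: l).getLast? := by
  induction h using Relation.ReflTransGen.head_induction_on with
  | refl => exact ⟨[], by simp⟩
  | @head a c hac _ ih =>
    obtain ⟨l, hnd, hch, hlast⟩ := ih
    by_cases ha : a ∈ c :: l
    · obtain ⟨s, t, hst⟩ := List.append_of_mem ha
      rw [hst] at hnd hch hlast
      refine ⟨t, (List.nodup_append.1 hnd).2.1, (List.isChain_append.1 hch).2.1, ?_⟩
      simpa [List.getLast?_append] using hlast
    · exact ⟨c :: l, List.nodup_cons.2 ⟨ha, hnd⟩, List.isChain_cons_cons.2 ⟨hac, hch⟩,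
        by simpa [List.getLast?_cons_cons] using hlast⟩

/-- The cycle is built as a product of transpositions, one per edge; the last clause keeps earlier
vertices fixed so that the induction can continue. -/
theorem exists_perm_of_chain {α : Type} [DecidableEq α] {r : α → α → Prop} (l : List α) (a b : α)
    (hnd : (a :: l).Nodup) (hch : (a :: l).IsChain r) (hlast : b ∈ (a :: l).getLast?) :
    ∃ π : Equiv.Perm α, π b = a ∧ (∀ x, x ≠ b → π x = x ∨ r x (π x)) ∧
      ∀ x, x ∉ a :: l → π x = x := by
  induction l generalizing a with
  | nil =>
    simp at hlast
    subst hlast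
    exact ⟨1, by simp, by simp, by simp⟩
  | cons c l ih =>
    rw [List.nodup_cons] at hnd
    rw [List.isChain_cons_cons] at hch
    obtain ⟨π, hb, hπ, hfix⟩ := ih c hnd.2 hch.2 (by simpa [List.getLast?_cons_cons] using hlast)
    have ha : π a = a := hfix a hnd.1
    refine ⟨Equiv.swap a c * π, by simp [hb], fun x hx => ?_, fun x hx => ?_⟩
    · by_cases hxa : x = a
      · right; subst hxa; simpa [ha] using hch.1
      · have h1 : π x ≠ a := fun h => hxa (π.injective (h.trans ha.symm))
        have h2 : π x ≠ c := fun h => hx (π.injective (h.trans hb.symm))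
        simpa [Equiv.swap_apply_of_ne_of_ne h1 h2] using hπ x hx
    · simp only [List.mem_cons, not_or] at hx
      have h3 : π x = x := hfix x (by simp [hx])
      simp [h3, Equiv.swap_apply_of_ne_of_ne hx.1 hx.2.1]

/-- A path from `a` to `b` can be closed to a cyclic permutation. -/
theorem exists_perm_of_reflTransGen {α : Type} {r : α → α → Prop} {a b : α}
    (h : Relation.ReflTransGen r a b) :
    ∃ π : Equiv.Perm α, π b = a ∧ ∀ x, x ≠ b → π x = x ∨ r x (π x) := by
  classical
  obtain ⟨l, hnd, hch, hlast⟩ := exists_nodup_chain h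
  obtain ⟨π, h1, h2, -⟩ := exists_perm_of_chain l a b hnd hch hlast
  exact ⟨π, h1, h2⟩

theorem splitGraph_adj_iff {n m : ℕ} (A : StructuredMatrix (Fin n) (Fin n))
    (B : StructuredMatrix (Fin n) (Fin m)) (a c : (Fin n ⊕ Fin m) ⊕ (Fin n ⊕ Fin m)) :
    (splitGraph A B).Adj a c ↔ ∃ u r, a = outCopy u ∧ c = inCopy (Sum.inl r) ∧
      (hcat A B r u = true ∨ u = Sum.inl r) := by
  constructor
  · rintro (⟨u, v, rfl, rfl, k, rfl, hk⟩ | ⟨k, hk⟩)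
    · exact ⟨u, k, rfl, rfl, Or.inl hk⟩
    · rw [Prod.mk.injEq] at hk
      exact ⟨_, k, hk.1, hk.2, Or.inr rfl⟩
  · rintro ⟨u, r, rfl, rfl, h | rfl⟩
    · exact Or.inl ⟨u, _, rfl, rfl, r, rfl, h⟩
    · exact Or.inr ⟨r, rfl⟩

/-- All edges run from out-copies to in-copies, so no path has two edges and no cycle can occur:
path families are just matchings. -/
theorem isPathFamily_splitGraph_iff {n m : ℕ} (A : StructuredMatrix (Fin n) (Fin n))
    (B : StructuredMatrix (Fin n) (Fin m))
    (D E : Set (((Fin n ⊕ Fin m) ⊕ (Fin n ⊕ Fin m)) × ((Fin n ⊕ Fin m) ⊕ (Fin n ⊕ Fin m)))) :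
    IsPathFamily (deleteEdges (splitGraph A B) D) E ↔
      IsLinking (deleteEdges (splitGraph A B) D) E := by
  refine ⟨fun h => h.isPathCycleFamily.isLinking, fun h => h.isPathFamily (Set.range Sum.inr) ?_⟩
  rintro a c ⟨hac, -⟩
  obtain ⟨u, r, rfl, rfl, -⟩ := (splitGraph_adj_iff A B a c).1 hac
  simp

/-- Every state of a controllable realization is reachable from the input. -/
theorem reachable_of_controllable {n : ℕ} {A : StructuredMatrix (Fin n) (Fin n)}
    {b : StructuredMatrix (Fin n) (Fin 1)} (hsc : StructurallyControllable A b)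
    (j : Fin n ⊕ Fin 1) :
    Relation.ReflTransGen (systemGraph A b).Adj (Sum.inr 0) j := by
  obtain ⟨M, hM, hc⟩ := hsc
  rcases j with j | j
  swap
  · rw [Subsingleton.elim j 0]
  have hreal : ∀ r u, M r u ≠ 0 → (systemGraph A b).Adj u (Sum.inl r) := fun r u h =>
    ⟨r, rfl, by
      by_contra hf
      exact h (hM r u (by simpa using hf))⟩
  have key : ∀ (k : ℕ) (r : Fin n), (M.toCols₁ ^ k * M.toCols₂) r 0 ≠ 0 →
      Relation.ReflTransGen (systemGraph A b).Adj (Sum.inr 0) (Sum.inl r) := by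
    intro k
    induction k with
    | zero =>
      intro r hr
      rw [pow_zero, Matrix.one_mul] at hr
      exact Relation.ReflTransGen.single (hreal r _ hr)
    | succ k ih =>
      intro r hr
      rw [pow_succ', Matrix.mul_assoc, Matrix.mul_apply] at hr
      obtain ⟨s, -, hs⟩ := Finset.exists_ne_zero_of_sum_ne_zero hr
      exact (ih s (right_ne_zero_of_mul hs)).tail (hreal r _ (left_ne_zero_of_mul hs))
  by_contra hj
  rw [controllable_iff_det] at hc
  refine hc (Matrix.det_eq_zero_of_row_eq_zero j fun k => ?_)
  by_contra hne
  exact hj (key _ _ hne)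

/-- The split graph without the edges out of `jᵒ` has a linking covering all states. -/
theorem exists_pathFamily_of_structurallyControllable {n : ℕ}
    {A : StructuredMatrix (Fin n) (Fin n)} {b : StructuredMatrix (Fin n) (Fin 1)}
    (hsc : StructurallyControllable A b) (j : Fin n ⊕ Fin 1) :
    ∃ M, IsPathFamily (deleteEdges (splitGraph A b) (outEdges (splitGraph A b) (outCopy j))) M ∧
      M.ncard = n := by
  -- A path from the input to `j`, closed to a permutation `π`, loses only the edge out of `j`.
  -- Fixed states use their `λ`-edges; the input is fixed only if it equals `j`, and then it is
  -- omitted anyway.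
  obtain ⟨π, hj, hπ⟩ := exists_perm_of_reflTransGen (reachable_of_controllable hsc j)
  refine ⟨(fun u => (outCopy u, inCopy (π u))) '' {u | u ≠ j},
    (isPathFamily_splitGraph_iff _ _ _ _).2 ⟨?_, ?_, ?_⟩, ?_⟩
  · rintro _ ⟨u, hu, rfl⟩
    refine ⟨?_, fun h => hu (by simpa using h.2)⟩
    rw [splitGraph_adj_iff]
    rcases hπ u hu with h | ⟨r, hr, hr'⟩
    · rcases u with u | u
      · exact ⟨_, u, rfl, congrArg inCopy h, Or.inr rfl⟩
      · rw [Subsingleton.elim u 0, ← hj] at h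
        exact absurd ((congrArg Sum.inr (Subsingleton.elim u 0)).trans (hj.symm.trans (π.injective h))) hu
    · exact ⟨u, r, rfl, congrArg inCopy hr, Or.inl hr'⟩
  · rintro _ ⟨u, hu, rfl⟩ _ ⟨v, hv, rfl⟩ h
    have : u = v := by simpa using h
    rw [this]
  · rintro _ ⟨u, hu, rfl⟩ _ ⟨v, hv, rfl⟩ h
    have : u = v := by simpa using h
    rw [this]
  · rw [Set.ncard_image_of_injective _ (fun u v h => by simpa using congrArg Prod.fst h)]
    have : {u | u ≠ j} = ({j} : Set (Fin n ⊕ Fin 1))ᶜ := rfl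
    rw [this, Set.ncard_compl]
    simp

end StructControl

/-! ### Transversals, strong classes and `GammaNz` in terms of permutations. -/

namespace StructControl

variable {n : ℕ} {A : StructuredMatrix (Fin n) (Fin n)} {b : StructuredMatrix (Fin n) (Fin 1)}
  {j : Fin n ⊕ Fin 1} {τ : Fin n → Fin n ⊕ Fin 1}

/-- The entry `(r, u)` of the pencil `[A - λ I, b]` is not fixed to zero. -/
def PencilEntry (A : StructuredMatrix (Fin n) (Fin n)) (b : StructuredMatrix (Fin n) (Fin 1))
    (r : Fin n) (u : Fin n ⊕ Fin 1) : Prop :=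
  hcat A b r u = true ∨ u = Sum.inl r

/-- `τ` matches each row of the pencil with a column other than `j`. -/
structure IsTransversal (A : StructuredMatrix (Fin n) (Fin n)) (b : StructuredMatrix (Fin n) (Fin 1))
    (j : Fin n ⊕ Fin 1) (τ : Fin n → Fin n ⊕ Fin 1) : Prop where
  inj : Function.Injective τ
  ne : ∀ r, τ r ≠ j
  entry : ∀ r, PencilEntry A b r (τ r)

theorem IsTransversal.surj (h : IsTransversal A b j τ) {u : Fin n ⊕ Fin 1} (hu : u ≠ j) :
    ∃ r, τ r = u := by
  have h1 : Set.range τ ⊆ {j}ᶜ := by rintro _ ⟨r, rfl⟩; exact h.ne r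
  have h2 : Set.range τ = {j}ᶜ := Set.eq_of_subset_of_ncard_le h1 (by
    rw [Set.ncard_compl, ← Set.image_univ, Set.ncard_image_of_injective _ h.inj, Set.ncard_univ]
    simp)
  exact (h2.symm ▸ hu : u ∈ Set.range τ)

/-- The edge of the split graph at position `(r, u)`. -/
abbrev splitEdge (u : Fin n ⊕ Fin 1) (r : Fin n) :
    ((Fin n ⊕ Fin 1) ⊕ (Fin n ⊕ Fin 1)) × ((Fin n ⊕ Fin 1) ⊕ (Fin n ⊕ Fin 1)) :=
  (outCopy u, inCopy (Sum.inl r))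

/-- The `n` edges have distinct heads among the `n` in-copies of states, so every state is hit
exactly once and `τ` reads off the tails. -/
theorem exists_transversal {M} (hM : IsPathFamily (deleteEdges (splitGraph A b) (outEdges (splitGraph A b) (outCopy j))) M)
    (hn : M.ncard = n) :
    ∃ τ, IsTransversal A b j τ ∧ M = Set.range fun r => splitEdge (τ r) r := by
  rw [isPathFamily_splitGraph_iff] at hM
  have hform : ∀ e ∈ M, ∃ u r, e = splitEdge u r ∧ u ≠ j ∧ PencilEntry A b r u := by
    intro e he
    obtain ⟨h1, h2⟩ := hM.adj e he
    obtain ⟨u, r, hu, hr, h3⟩ := (splitGraph_adj_iff _ _ _ _).1 h1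
    refine ⟨u, r, Prod.ext hu hr, ?_, h3⟩
    rintro rfl
    exact h2 ⟨h1, hu⟩
  have hall : ∀ r : Fin n, ∃ u, splitEdge u r ∈ M := by
    have h1 : Prod.snd '' M ⊆ Set.range fun r : Fin n => (inCopy (Sum.inl r) :
        (Fin n ⊕ Fin 1) ⊕ (Fin n ⊕ Fin 1)) := by
      rintro _ ⟨e, he, rfl⟩
      obtain ⟨u, r, rfl, -⟩ := hform e he
      exact ⟨r, rfl⟩
    have h2 := Set.eq_of_subset_of_ncard_le h1 (by
      rw [Set.InjOn.ncard_image hM.injSnd, hn, ← Set.image_univ,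
        Set.ncard_image_of_injective _ (fun r s h => by simpa using h), Set.ncard_univ]
      simp)
    intro r
    have : inCopy (Sum.inl r) ∈ Prod.snd '' M := h2 ▸ ⟨r, rfl⟩
    obtain ⟨e, he, her⟩ := this
    obtain ⟨u, r', rfl, -⟩ := hform e he
    have : r' = r := by simpa using her
    exact ⟨u, this ▸ he⟩
  choose τ hτ using hall
  have hM' : M = Set.range fun r => splitEdge (τ r) r := by
    ext e
    constructor
    · intro he
      obtain ⟨u, r, rfl, -⟩ := hform e he
      exact ⟨r, hM.injSnd (hτ r) he rfl⟩
    · rintro ⟨r, rfl⟩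
      exact hτ r
  refine ⟨τ, ⟨?_, fun r => ?_, fun r => ?_⟩, hM'⟩
  · intro r s h
    have := hM.injFst (hτ r) (hτ s) (by simp [h])
    simpa using congrArg Prod.snd this
  · obtain ⟨u, r', h, hu, -⟩ := hform _ (hτ r)
    have : τ r = u := by simpa using congrArg Prod.fst h
    rwa [this]
  · obtain ⟨u, r', h, -, hp⟩ := hform _ (hτ r)
    have h1 : τ r = u := by simpa using congrArg Prod.fst h
    have h2 : r = r' := by simpa using congrArg Prod.snd h
    rwa [h1, h2]

/-- The digraph on the rows obtained by identifying each row `r` with the column `τ r`. -/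
def Step (A : StructuredMatrix (Fin n) (Fin n)) (b : StructuredMatrix (Fin n) (Fin 1))
    (τ : Fin n → Fin n ⊕ Fin 1) (s r : Fin n) : Prop :=
  PencilEntry A b r (τ s)

/-- The rows in the strongly connected class of `s`. -/
def stepClass (A : StructuredMatrix (Fin n) (Fin n)) (b : StructuredMatrix (Fin n) (Fin 1))
    (τ : Fin n → Fin n ⊕ Fin 1) (s : Fin n) : Set (Fin n) :=
  {r | Relation.ReflTransGen (Step A b τ) s r ∧ Relation.ReflTransGen (Step A b τ) r s}

/-- The vertices of the split graph that belong to the rows in `K` and their columns. -/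
def splitClass (τ : Fin n → Fin n ⊕ Fin 1) (K : Set (Fin n)) :
    Set ((Fin n ⊕ Fin 1) ⊕ (Fin n ⊕ Fin 1)) :=
  {a | ∃ r ∈ K, a = inCopy (Sum.inl r) ∨ a = outCopy (τ r)}

theorem inCopy_mem_splitClass {K : Set (Fin n)} {r : Fin n} :
    inCopy (Sum.inl r) ∈ splitClass τ K ↔ r ∈ K := by
  simp [splitClass]

theorem IsTransversal.outCopy_mem_splitClass (h : IsTransversal A b j τ) {K : Set (Fin n)}
    {r : Fin n} : outCopy (τ r) ∈ splitClass τ K ↔ r ∈ K := by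
  simp [splitClass, h.inj.eq_iff]

theorem IsTransversal.ncard_outCopy (h : IsTransversal A b j τ) (K : Set (Fin n)) :
    {u | outCopy u ∈ splitClass τ K}.ncard = K.ncard := by
  rw [← Set.ncard_image_of_injective K h.inj]
  congr 1
  ext u
  simp [splitClass, eq_comm]

/-- The in-copy of `r` and the out-copy of `τ r` reach each other: one way by the reversed edge of
the family, the other way by the edge itself. Contracting these pairs by `φ` turns the residual
graph into `Step`. -/
theorem IsTransversal.isComponent_iff (h : IsTransversal A b j τ)
    (C : Set ((Fin n ⊕ Fin 1) ⊕ (Fin n ⊕ Fin 1))) :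
    IsComponent A b j (Set.range fun r => splitEdge (τ r) r) C ↔
      ∃ s, C = splitClass τ (stepClass A b τ s) := by
  set G := residualGraph A b j (Set.range fun r => splitEdge (τ r) r) with hG
  let inV : Fin n → ReducedVertex j := fun s => ⟨inCopy (Sum.inl s), by simp⟩
  let outV : Fin n → ReducedVertex j := fun s => ⟨outCopy (τ s), by simpa using h.ne s⟩
  have hcases : ∀ a : ReducedVertex j, ∃ s, a = inV s ∨ a = outV s := by
    rintro ⟨((s | u) | u), h1, h2⟩
    · exact ⟨s, Or.inl rfl⟩
    · exact absurd (congrArg (fun v => inCopy (Sum.inr v)) (Subsingleton.elim u 0)) h1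
    · obtain ⟨s, rfl⟩ := h.surj (u := u) (by rintro rfl; exact h2 rfl)
      exact ⟨s, Or.inr rfl⟩
  choose φ hφ using hcases
  have hin : ∀ s, φ (inV s) = s := fun s => by
    rcases hφ (inV s) with h1 | h1
    · simpa [inV] using (congrArg Subtype.val h1).symm
    · simpa [inV, outV] using congrArg Subtype.val h1
  have hout : ∀ s, φ (outV s) = s := fun s => by
    rcases hφ (outV s) with h1 | h1
    · simpa [inV, outV] using congrArg Subtype.val h1
    · have := congrArg Subtype.val h1
      simp only [outV, outCopy, Sum.inr.injEq] at this
      exact (h.inj this).symm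
  have hio : ∀ s, G.Adj (inV s) (outV s) := fun s => Or.inr ⟨s, rfl⟩
  have hoi : ∀ s r, Step A b τ s r → G.Adj (outV s) (inV r) := fun s r hsr =>
    Or.inl ((splitGraph_adj_iff _ _ _ _).2 ⟨_, r, rfl, rfl, hsr⟩)
  have hstep : ∀ a c, Step A b τ (φ a) (φ c) → Relation.ReflTransGen G.Adj a c := by
    intro a c hac
    have h1 : Relation.ReflTransGen G.Adj a (outV (φ a)) := by
      rcases hφ a with h1 | h1
      · conv_lhs => rw [h1]
        exact Relation.ReflTransGen.single (hio _)
      · rw [← h1]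
    have h2 : Relation.ReflTransGen G.Adj (inV (φ c)) c := by
      rcases hφ c with h2 | h2
      · rw [← h2]
      · conv_rhs => rw [h2]
        exact Relation.ReflTransGen.single (hio _)
    exact (h1.tail (hoi _ _ hac)).trans h2
  have hadj : ∀ a c, G.Adj a c → Relation.ReflTransGen (Step A b τ) (φ a) (φ c) := by
    rintro a c (hac | ⟨r, hr⟩)
    · obtain ⟨u, r, hu, hr, hp⟩ := (splitGraph_adj_iff _ _ _ _).1 hac
      have hc : c = inV r := Subtype.ext hr
      obtain ⟨s, rfl⟩ := h.surj (u := u) (by rintro rfl; exact a.2.2 hu)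
      have ha : a = outV s := Subtype.ext hu
      rw [ha, hc, hin, hout]
      exact Relation.ReflTransGen.single hp
    · have hc : c = outV r := Subtype.ext (congrArg Prod.fst hr).symm
      have ha : a = inV r := Subtype.ext (congrArg Prod.snd hr).symm
      rw [ha, hc, hin, hout]
  have hreach : ∀ a c, Relation.ReflTransGen G.Adj a c ↔
      Relation.ReflTransGen (Step A b τ) (φ a) (φ c) := by
    intro a c
    constructor
    · intro hac
      induction hac with
      | refl => exact Relation.ReflTransGen.refl
      | tail _ hcd ih => exact ih.trans (hadj _ _ hcd)
    · intro hac
      have : ∀ r, Relation.ReflTransGen (Step A b τ) (φ a) r →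
          Relation.ReflTransGen G.Adj a (inV r) := by
        intro r hr
        induction hr with
        | refl => exact hstep _ _ (by rw [hin]; exact h.entry _)
        | tail _ hcd ih => exact ih.trans (hstep _ _ (by rwa [hin, hin]))
      exact (this _ hac).trans (hstep _ _ (by rw [hin]; exact h.entry _))
  have hclass : ∀ v : ReducedVertex j,
      Subtype.val '' {w | Relation.ReflTransGen G.Adj v w ∧ Relation.ReflTransGen G.Adj w v} =
        splitClass τ (stepClass A b τ (φ v)) := by
    intro v
    ext a
    constructor
    · rintro ⟨w, ⟨h1, h2⟩, rfl⟩
      refine ⟨φ w, ⟨(hreach _ _).1 h1, (hreach _ _).1 h2⟩, ?_⟩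
      rcases hφ w with h3 | h3
      · exact Or.inl (congrArg Subtype.val h3)
      · exact Or.inr (congrArg Subtype.val h3)
    · rintro ⟨r, ⟨h1, h2⟩, rfl | rfl⟩
      · exact ⟨inV r, ⟨(hreach _ _).2 (by rwa [hin]), (hreach _ _).2 (by rwa [hin])⟩, rfl⟩
      · exact ⟨outV r, ⟨(hreach _ _).2 (by rwa [hout]), (hreach _ _).2 (by rwa [hout])⟩, rfl⟩
  constructor
  · rintro ⟨_, ⟨v, rfl⟩, rfl⟩
    exact ⟨φ v, hclass v⟩
  · rintro ⟨s, rfl⟩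
    exact ⟨_, ⟨inV s, rfl⟩, by rw [hclass, hin]⟩

/-- `π` permutes `K` along the edges of `Step` and fixes everything else. -/
structure IsClassPerm (A : StructuredMatrix (Fin n) (Fin n)) (b : StructuredMatrix (Fin n) (Fin 1))
    (τ : Fin n → Fin n ⊕ Fin 1) (K : Set (Fin n)) (π : Equiv.Perm (Fin n)) : Prop where
  fix : ∀ s, s ∉ K → π s = s
  mem : ∀ s ∈ K, π s ∈ K
  step : ∀ s ∈ K, Step A b τ s (π s)

/-- The number of `λ`-entries met by `π` in the columns of `K`. -/
noncomputable def lambdaCount (τ : Fin n → Fin n ⊕ Fin 1) (K : Set (Fin n)) (π : Equiv.Perm (Fin n)) : ℕ :=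
  {s | s ∈ K ∧ τ s = Sum.inl (π s)}.ncard

theorem IsTransversal.isClassPerm_one (h : IsTransversal A b j τ) (K : Set (Fin n)) :
    IsClassPerm A b τ K 1 := ⟨by simp, by simp, fun s _ => h.entry s⟩

theorem IsTransversal.mem_inducedEdges_iff (h : IsTransversal A b j τ) {K : Set (Fin n)} {e} :
    e ∈ inducedEdges (splitGraph A b) (splitClass τ K) ↔
      ∃ s ∈ K, ∃ r ∈ K, e = splitEdge (τ s) r ∧ Step A b τ s r := by
  constructor
  · rintro ⟨h1, h2, h3⟩
    obtain ⟨u, r, hu, hr, hp⟩ := (splitGraph_adj_iff _ _ _ _).1 h1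
    rw [hr, inCopy_mem_splitClass] at h3
    rw [hu] at h2
    obtain ⟨s, hs, hs'⟩ := h2
    have hs'' : u = τ s := by simpa using hs'
    exact ⟨s, hs, r, h3, Prod.ext (by rw [hu, hs'']) hr, by rw [hs''] at hp; exact hp⟩
  · rintro ⟨s, hs, r, hr, rfl, hp⟩
    exact ⟨(splitGraph_adj_iff _ _ _ _).2 ⟨_, r, rfl, rfl, hp⟩,
      h.outCopy_mem_splitClass.2 hs, inCopy_mem_splitClass.2 hr⟩

theorem isLambdaEdge_splitEdge (u : Fin n ⊕ Fin 1) (r : Fin n) :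
    IsLambdaEdge (splitEdge u r) ↔ u = Sum.inl r := by
  constructor
  · rintro ⟨k, hk⟩
    have h1 : u = Sum.inl k := by simpa using congrArg Prod.fst hk
    have h2 : r = k := by simpa using congrArg Prod.snd hk
    rw [h1, h2]
  · rintro rfl
    exact ⟨r, rfl⟩

theorem IsTransversal.ncard_matching_le (h : IsTransversal A b j τ) {K : Set (Fin n)} {N}
    (hN : IsMatching (inducedEdges (splitGraph A b) (splitClass τ K)) N) : N.ncard ≤ K.ncard := by
  have hinj : Set.InjOn Prod.fst N := fun e he f hf hef => by
    by_contra hne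
    exact (hN.2 e he f hf hne).1 hef
  rw [← Set.InjOn.ncard_image hinj,
    ← Set.ncard_image_of_injective K (f := fun s => (outCopy (τ s) :
      (Fin n ⊕ Fin 1) ⊕ (Fin n ⊕ Fin 1))) (fun r s hrs => h.inj (by simpa using hrs))]
  refine Set.ncard_le_ncard ?_
  rintro _ ⟨e, he, rfl⟩
  obtain ⟨s, hs, r, -, rfl, -⟩ := h.mem_inducedEdges_iff.1 (hN.1 he)
  exact ⟨s, hs, rfl⟩

theorem IsTransversal.isMatching_perm (h : IsTransversal A b j τ) {K : Set (Fin n)}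
    {π : Equiv.Perm (Fin n)} (hπ : IsClassPerm A b τ K π) :
    IsMatching (inducedEdges (splitGraph A b) (splitClass τ K))
      ((fun s => splitEdge (τ s) (π s)) '' K) := by
  constructor
  · rintro _ ⟨s, hs, rfl⟩
    exact h.mem_inducedEdges_iff.2 ⟨s, hs, _, hπ.mem s hs, rfl, hπ.step s hs⟩
  · rintro _ ⟨s, hs, rfl⟩ _ ⟨r, hr, rfl⟩ hne
    have hsr : s ≠ r := fun h => hne (by rw [h])
    simpa [h.inj.eq_iff] using hsr

theorem IsTransversal.injective_permEdge (h : IsTransversal A b j τ) (π : Equiv.Perm (Fin n)) :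
    Function.Injective fun s => splitEdge (τ s) (π s) := fun r s hrs =>
  h.inj (by simpa using congrArg Prod.fst hrs)

/-- The identity already gives a matching covering the class, so maximum matchings cover every
column and row of `K`, which makes them permutations. -/
theorem IsTransversal.mem_lambdaCounts_iff (h : IsTransversal A b j τ) {K : Set (Fin n)} {k : ℕ} :
    k ∈ lambdaCounts A b (splitClass τ K) ↔
      ∃ π, IsClassPerm A b τ K π ∧ lambdaCount τ K π = k := by
  classical
  have hcount : ∀ π : Equiv.Perm (Fin n),
      {e | e ∈ (fun s => splitEdge (τ s) (π s)) '' K ∧ IsLambdaEdge e}.ncard =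
        lambdaCount τ K π := by
    intro π
    rw [lambdaCount, ← Set.ncard_image_of_injective _ (h.injective_permEdge π)]
    congr 1
    ext e
    constructor
    · rintro ⟨⟨s, hs, rfl⟩, he⟩
      exact ⟨s, ⟨hs, (isLambdaEdge_splitEdge _ _).1 he⟩, rfl⟩
    · rintro ⟨s, ⟨hs, he⟩, rfl⟩
      exact ⟨⟨s, hs, rfl⟩, (isLambdaEdge_splitEdge _ _).2 he⟩
  have hmax : ∀ π, IsClassPerm A b τ K π →
      IsMaximumMatching (inducedEdges (splitGraph A b) (splitClass τ K))
        ((fun s => splitEdge (τ s) (π s)) '' K) := fun π hπ =>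
    ⟨h.isMatching_perm hπ, fun N' hN' => by
      rw [Set.ncard_image_of_injective _ (h.injective_permEdge π)]
      exact h.ncard_matching_le hN'⟩
  constructor
  · rintro ⟨N, ⟨hN, hNmax⟩, rfl⟩
    have hcard : N.ncard = K.ncard := by
      refine le_antisymm (h.ncard_matching_le hN) ?_
      have := hNmax _ (hmax 1 (h.isClassPerm_one K)).1
      rwa [Set.ncard_image_of_injective _ (h.injective_permEdge 1)] at this
    have hex : ∀ s ∈ K, ∃ r ∈ K, splitEdge (τ s) r ∈ N ∧ Step A b τ s r := by
      have hinj : Set.InjOn Prod.fst N := fun e he f hf hef => by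
        by_contra hne
        exact (hN.2 e he f hf hne).1 hef
      have hsub : Prod.fst '' N ⊆ (fun s => (outCopy (τ s) :
          (Fin n ⊕ Fin 1) ⊕ (Fin n ⊕ Fin 1))) '' K := by
        rintro _ ⟨e, he, rfl⟩
        obtain ⟨s, hs, r, -, rfl, -⟩ := h.mem_inducedEdges_iff.1 (hN.1 he)
        exact ⟨s, hs, rfl⟩
      have heq := Set.eq_of_subset_of_ncard_le hsub (by
        rw [Set.InjOn.ncard_image hinj, hcard, Set.ncard_image_of_injective]
        exact fun r s hrs => h.inj (by simpa using hrs))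
      intro s hs
      have : outCopy (τ s) ∈ Prod.fst '' N := heq ▸ ⟨s, hs, rfl⟩
      obtain ⟨e, he, hes⟩ := this
      obtain ⟨s', hs', r, hr, rfl, hp⟩ := h.mem_inducedEdges_iff.1 (hN.1 he)
      have : s' = s := h.inj (by simpa using hes)
      subst this
      exact ⟨r, hr, he, hp⟩
    choose! f hfK hfN hfp using hex
    let g : Fin n → Fin n := fun s => if s ∈ K then f s else s
    have hg : ∀ s ∈ K, g s = f s := fun s hs => if_pos hs
    have hg' : ∀ s, s ∉ K → g s = s := fun s hs => if_neg hs
    have hginj : Function.Injective g := by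
      intro s r hsr
      by_cases hs : s ∈ K <;> by_cases hr : r ∈ K
      · rw [hg s hs, hg r hr] at hsr
        by_contra hne
        have := hN.2 _ (hfN s hs) _ (hfN r hr) (fun h1 => hne (h.inj (by
          simpa using congrArg Prod.fst h1)))
        exact this.2.2.2 (by simp [hsr])
      · rw [hg s hs, hg' r hr] at hsr
        exact absurd (hsr ▸ hfK s hs) hr
      · rw [hg' s hs, hg r hr] at hsr
        exact absurd (hsr ▸ hfK r hr) hs
      · rwa [hg' s hs, hg' r hr] at hsr
    let π : Equiv.Perm (Fin n) := Equiv.ofBijective g (Finite.injective_iff_bijective.1 hginj)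
    have hπ : IsClassPerm A b τ K π :=
      ⟨hg', fun s hs => by change g s ∈ K; rw [hg s hs]; exact hfK s hs,
        fun s hs => by change Step A b τ s (g s); rw [hg s hs]; exact hfp s hs⟩
    refine ⟨π, hπ, ?_⟩
    rw [← hcount]
    have : (fun s => splitEdge (τ s) (π s)) '' K = N := by
      refine Set.eq_of_subset_of_ncard_le ?_ ?_
      · rintro _ ⟨s, hs, rfl⟩
        change splitEdge (τ s) (g s) ∈ N
        rw [hg s hs]
        exact hfN s hs
      · rw [hcard, Set.ncard_image_of_injective _ (h.injective_permEdge π)]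
    rw [this]
  · rintro ⟨π, hπ, rfl⟩
    exact ⟨_, hmax π hπ, hcount π⟩

/-- The attained counts form a nonempty bounded set containing that of the identity, so minimum and
maximum differ exactly when some permutation deviates from the identity. -/
theorem IsTransversal.gammaNz_iff (h : IsTransversal A b j τ) {K : Set (Fin n)} :
    GammaNz A b (splitClass τ K) ↔
      (∃ π, IsClassPerm A b τ K π ∧ lambdaCount τ K π ≠ lambdaCount τ K 1) ∨
        ∃ s ∈ K, ∃ r ∈ K, τ s = Sum.inl r ∧ A r r = true := by
  have hne : (lambdaCounts A b (splitClass τ K)).Nonempty :=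
    ⟨_, h.mem_lambdaCounts_iff.2 ⟨1, h.isClassPerm_one K, rfl⟩⟩
  have hbdd : BddAbove (lambdaCounts A b (splitClass τ K)) := by
    refine ⟨K.ncard, fun k hk => ?_⟩
    obtain ⟨π, -, rfl⟩ := h.mem_lambdaCounts_iff.1 hk
    exact Set.ncard_le_ncard fun s hs => hs.1
  refine or_congr ?_ ?_
  · constructor
    · intro hlt
      obtain ⟨π, hπ, h1⟩ := h.mem_lambdaCounts_iff.1 (Nat.sInf_mem hne)
      obtain ⟨π', hπ', h2⟩ := h.mem_lambdaCounts_iff.1 (Nat.sSup_mem hne hbdd)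
      by_contra! hall
      rw [gammaMin, gammaMax, ← h1, ← h2, hall π hπ, hall π' hπ'] at hlt
      exact lt_irrefl _ hlt
    · rintro ⟨π, hπ, hcnt⟩
      have m1 := h.mem_lambdaCounts_iff.2 ⟨π, hπ, rfl⟩
      have m2 := h.mem_lambdaCounts_iff.2 ⟨1, h.isClassPerm_one K, rfl⟩
      have a1 := Nat.sInf_le m1
      have a2 := Nat.sInf_le m2
      have b1 := le_csSup hbdd m1
      have b2 := le_csSup hbdd m2
      rw [gammaMin, gammaMax]
      omega
  · constructor
    · rintro ⟨k, hk, hA⟩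
      obtain ⟨s, hs, r, hr, he, -⟩ := h.mem_inducedEdges_iff.1 hk
      have h1 : Sum.inl k = τ s := by simpa using congrArg Prod.fst he
      have h2 : k = r := by simpa using congrArg Prod.snd he
      exact ⟨s, hs, r, hr, by rw [← h1, h2], by rwa [← h2]⟩
    · rintro ⟨s, hs, r, hr, he, hA⟩
      exact ⟨r, h.mem_inducedEdges_iff.2 ⟨s, hs, r, hr, by simp [splitEdge, he],
        Or.inr he⟩, hA⟩

end StructControl

/-! ### Singular realizations from weighted Laplacians. -/

namespace StructControl

open scoped Matrix

section Laplacian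

variable {D : Type} [Fintype D]

/-- The left kernel of a weighted Laplacian, all of whose vertices reach `s₀`, is spanned by the
constant vectors. -/
theorem eq_const_of_laplacian {H : D → D → Prop} {s₀ : D}
    (hreach : ∀ s, Relation.ReflTransGen H s s₀) {c : D → D → ℝ} (hc : ∀ r s, 0 ≤ c r s)
    (hcH : ∀ r s, H s r → 0 < c r s) {w : D → ℂ}
    (hw : ∀ s, w s * (∑ r, c r s : ℝ) = ∑ r, w r * (c r s : ℝ)) (r : D) : w r = w s₀ := by
  let u : D → ℂ := fun s => w s - w s₀
  have hu : ∀ s, u s * (∑ r, c r s : ℝ) = ∑ r, u r * (c r s : ℝ) := by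
    intro s
    simp only [u, sub_mul, Finset.sum_sub_distrib, ← Finset.mul_sum]
    rw [hw s]
    push_cast
    rfl
  have : Nonempty D := ⟨s₀⟩
  obtain ⟨m, -, hm⟩ := Finset.exists_max_image Finset.univ (fun s => ‖u s‖) Finset.univ_nonempty
  -- Maximum principle: `u s` is a weighted average of the values at its out-neighbours, so a
  -- maximal modulus at `s` spreads along `H`. It reaches `s₀`, where `u` vanishes.
  have hprop : ∀ s r, ‖u s‖ = ‖u m‖ → H s r → ‖u r‖ = ‖u m‖ := by
    intro s r hs hsr
    have h1 : ‖u s‖ * ∑ r, c r s ≤ ∑ r, ‖u r‖ * c r s := by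
      have h2 : ‖u s * (∑ r, c r s : ℝ)‖ = ‖u s‖ * ∑ r, c r s := by
        rw [norm_mul, Complex.norm_real, Real.norm_of_nonneg (Finset.sum_nonneg fun r _ => hc r s)]
      rw [← h2, hu s]
      refine (norm_sum_le _ _).trans (le_of_eq (Finset.sum_congr rfl fun r _ => ?_))
      rw [norm_mul, Complex.norm_real, Real.norm_of_nonneg (hc r s)]
    by_contra hne
    have hlt : ‖u r‖ < ‖u m‖ := lt_of_le_of_ne (hm r (Finset.mem_univ r)) hne
    have h3 : ∑ r, ‖u r‖ * c r s < ∑ r, ‖u m‖ * c r s :=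
      Finset.sum_lt_sum (fun q _ => mul_le_mul_of_nonneg_right (hm q (Finset.mem_univ q)) (hc q s))
        ⟨r, Finset.mem_univ r, mul_lt_mul_of_pos_right hlt (hcH r s hsr)⟩
    rw [← Finset.mul_sum, ← hs] at h3
    exact absurd h1 (not_le.2 h3)
  have hall : ∀ r, Relation.ReflTransGen H m r → ‖u r‖ = ‖u m‖ := by
    intro r hr
    induction hr with
    | refl => rfl
    | tail _ h ih => exact hprop _ _ ih h
  have h0 : ‖u m‖ = 0 := by rw [← hall s₀ (hreach m)]; simp [u]
  have hr := hm r (Finset.mem_univ r)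
  rw [h0] at hr
  exact sub_eq_zero.1 (norm_le_zero_iff.1 hr)

variable [DecidableEq D]

/-- The cofactor is the determinant with row `i` replaced by the unit vector at `s₀`. Pairing a left
null vector `y` of that matrix with `z` gives `y i * z s₀ = 0`, so `y i = 0`; then `y` lies in the
left kernel of `Z` and must vanish. -/
theorem adjugate_ne_zero_of_kernels {Z : Matrix D D ℂ} {s₀ i : D} {z : D → ℂ}
    (hker : ∀ w, w ᵥ* Z = 0 → w i = 0 → w = 0) (hz : Z *ᵥ z = 0) (hz₀ : z s₀ ≠ 0) :
    Z.adjugate s₀ i ≠ 0 := by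
  rw [Matrix.adjugate_apply, Ne, ← Matrix.exists_vecMul_eq_zero_iff]
  rintro ⟨y, hy, h⟩
  have hrow : ∀ s, ∑ r, y r * Z r s = y i * (Z i s - if s = s₀ then 1 else 0) := by
    intro s
    have h1 : ∑ r, y r * (Z.updateRow i (Pi.single s₀ 1)) r s = 0 := congrFun h s
    rw [Finset.sum_eq_add_sum_sdiff_singleton_of_mem (Finset.mem_univ i)] at h1 ⊢
    have h2 : ∑ r ∈ Finset.univ \ {i}, y r * (Z.updateRow i (Pi.single s₀ 1)) r s =
        ∑ r ∈ Finset.univ \ {i}, y r * Z r s :=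
      Finset.sum_congr rfl fun r hr => by
        rw [Matrix.updateRow_ne (by simpa using hr)]
    rw [h2, Matrix.updateRow_self, Pi.single_apply] at h1
    linear_combination h1
  have hyi : y i = 0 := by
    have h1 : ∑ s, (∑ r, y r * Z r s) * z s = 0 := by
      have : (y ᵥ* Z) ⬝ᵥ z = 0 := by rw [← Matrix.dotProduct_mulVec, hz, dotProduct_zero]
      exact this
    simp_rw [hrow] at h1
    have h2 : ∑ s, Z i s * z s = 0 := congrFun hz i
    have h3 : ∑ s, y i * (Z i s - if s = s₀ then 1 else 0) * z s =
        y i * ∑ s, Z i s * z s - y i * z s₀ := by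
      rw [Finset.mul_sum]
      have : y i * z s₀ = ∑ s, y i * (if s = s₀ then 1 else 0) * z s := by simp
      rw [this, ← Finset.sum_sub_distrib]
      exact Finset.sum_congr rfl fun s _ => by ring
    rw [h3, h2, mul_zero, zero_sub, neg_eq_zero] at h1
    exact (mul_eq_zero.1 h1).resolve_right hz₀
  have hyZ : y ᵥ* Z = 0 := by
    ext s
    have := hrow s
    rw [hyi, zero_mul] at this
    exact this
  exact hy (hker y hyZ hyi)

theorem adjugate_ne_zero_of_leftKernel {Z : Matrix D D ℂ} {s₀ : D} {z : D → ℂ}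
    (hker : ∀ w, w ᵥ* Z = 0 → ∀ r, w r = w s₀) (hz : Z *ᵥ z = 0) (hz₀ : z s₀ ≠ 0) (i : D) :
    Z.adjugate s₀ i ≠ 0 :=
  adjugate_ne_zero_of_kernels (fun w hw hwi => funext fun r => by
    rw [hker w hw r, ← hker w hw i, hwi]; rfl) hz hz₀

/-- First-order perturbation. If the determinant vanished for all `c`, the adjugate row `w c` would
be a left null vector of `Z - c • J`; applying it to `z` gives `w c ⬝ᵥ (J *ᵥ z) = 0` for `c ≠ 0`,
hence at `0` by continuity. But `w 0` is a nonzero constant vector, contradicting `hJ`. -/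
theorem exists_det_sub_smul_ne_zero {Z J : Matrix D D ℂ} {s₀ : D} {z : D → ℂ}
    (hker : ∀ w, w ᵥ* Z = 0 → ∀ r, w r = w s₀) (hz : Z *ᵥ z = 0) (hz₀ : z s₀ ≠ 0)
    (hJ : ∑ r, (J *ᵥ z) r ≠ 0) : ∃ c : ℂ, (Z - c • J).det ≠ 0 := by
  by_contra! hdet
  let w : ℂ → D → ℂ := fun c => (Z - c • J).adjugate s₀
  have hw : ∀ c, w c ᵥ* (Z - c • J) = 0 := by
    intro c
    ext s
    have := congrFun (congrFun (Matrix.adjugate_mul (Z - c • J)) s₀) s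
    rw [hdet c, zero_smul] at this
    exact this
  have hcont : Continuous fun c => w c ⬝ᵥ (J *ᵥ z) := by
    have h1 : Continuous fun c : ℂ => Z - c • J := by fun_prop
    have h2 : Continuous w := (continuous_apply s₀).comp h1.matrix_adjugate
    exact h2.dotProduct continuous_const
  have hzero : ∀ c : ℂ, c ≠ 0 → w c ⬝ᵥ (J *ᵥ z) = 0 := by
    intro c hc
    have h1 : (w c ᵥ* (Z - c • J)) ⬝ᵥ z = 0 := by rw [hw, zero_dotProduct]
    rw [← Matrix.dotProduct_mulVec, Matrix.sub_mulVec, hz, Matrix.smul_mulVec, zero_sub,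
      dotProduct_neg, neg_eq_zero, dotProduct_smul, smul_eq_mul] at h1
    exact (mul_eq_zero.1 h1).resolve_left hc
  have h0 : w 0 ⬝ᵥ (J *ᵥ z) = 0 := by
    have hcl : IsClosed {c : ℂ | w c ⬝ᵥ (J *ᵥ z) = 0} := isClosed_eq hcont continuous_const
    have hd : Dense ({0}ᶜ : Set ℂ) := dense_compl_singleton 0
    have : closure ({0}ᶜ : Set ℂ) ⊆ {c : ℂ | w c ⬝ᵥ (J *ᵥ z) = 0} :=
      closure_minimal (fun c hc => hzero c hc) hcl
    exact this (hd 0)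
  have hw0 : ∀ r, w 0 r = w 0 s₀ := hker (w 0) (by simpa using hw 0)
  have hne : w 0 s₀ ≠ 0 := by
    have := adjugate_ne_zero_of_leftKernel hker hz hz₀ s₀
    simpa [w] using this
  have : w 0 ⬝ᵥ (J *ᵥ z) = w 0 s₀ * ∑ r, (J *ᵥ z) r := by
    rw [dotProduct, Finset.mul_sum]
    exact Finset.sum_congr rfl fun r _ => by rw [hw0 r]
  rw [this] at h0
  exact (mul_ne_zero hne hJ) h0

/-- A linear form in `(α, μ)` with a nonzero coefficient cannot vanish on all admissible weights:
compare two values of `μ`, or raise one `α q`. -/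
theorem exists_positive_weights {ι : Type} [DecidableEq ι] (P : Finset ι) (g : ι → ℝ) (N : ℝ)
    (h : N ≠ 0 ∨ ∃ p ∈ P, g p ≠ 0) :
    ∃ (α : ι → ℝ) (μ : ℝ), (∀ p, 0 < α p) ∧ μ ≠ 0 ∧ ∑ p ∈ P, α p * g p + μ * N ≠ 0 := by
  by_contra! hall
  have h1 := hall (fun _ => 1) 1 (by simp) one_ne_zero
  rcases h with hN | ⟨q, hq, hg⟩
  · have h2 := hall (fun _ => 1) 2 (by simp) two_ne_zero
    exact hN (by linear_combination h2 - h1)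
  · have h2 := hall (fun p => 1 + if p = q then 1 else 0) 1
      (fun p => by split_ifs <;> norm_num) one_ne_zero
    simp only [add_mul, ite_mul, zero_mul, one_mul, Finset.sum_add_distrib, Finset.sum_ite_eq',
      hq, if_true] at h1 h2
    exact hg (by linear_combination h2 - h1)

/-- A singular matrix of the given pattern with left kernel spanned by the constant vectors, whose
determinant does not vanish identically along the direction `J` of the `λ`-entries. -/
theorem exists_singular_realization {H lam free : D → D → Prop} [∀ s r, Decidable (lam s r)]
    (hrefl : ∀ s, H s s)
    (hlamH : ∀ s r, lam s r → H s r) (hfun : ∀ s r r', lam s r → lam s r' → r = r') {s₀ : D}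
    (hreach : ∀ s, Relation.ReflTransGen H s s₀)
    (hnz : (∃ π : Equiv.Perm D, (∀ s, H s (π s)) ∧
        {s | Relation.ReflTransGen H s₀ s ∧ lam s (π s)}.ncard ≠
          {s | Relation.ReflTransGen H s₀ s ∧ lam s s}.ncard) ∨
      ∃ s r, Relation.ReflTransGen H s₀ s ∧ lam s r ∧ free s r) :
    ∃ Z : Matrix D D ℂ, (∀ s r, ¬ H s r → Z r s = 0) ∧
      (∀ s r, lam s r → ¬ free s r → Z r s = -1) ∧ Z.det = 0 ∧
      (∀ i, Z.adjugate s₀ i ≠ 0) ∧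
      ∃ c : ℂ, (Z - c • Matrix.of fun r s => if lam s r then (1 : ℂ) else 0).det ≠ 0 := by
  classical
  -- A `pure` entry of the pencil is exactly `-c`, so it must be `-1` at `c = 1`; a free `λ`-entry
  -- may take any value.
  let pure : D → D → Prop := fun s r => lam s r ∧ ¬ free s r
  let inK : D → Prop := fun s => Relation.ReflTransGen H s₀ s
  let P : Finset (Equiv.Perm D) := Finset.univ.filter fun π => ∀ s, H s (π s)
  let g : Equiv.Perm D → ℝ := fun π => ∑ s, if inK s then
    ((if pure s (π s) then 1 else 0) - (if pure s s then 1 else 0)) else 0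
  let N : ℝ := ∑ s, if inK s ∧ ∃ r, lam s r ∧ free s r then 1 else 0
  have hcond : N ≠ 0 ∨ ∃ p ∈ P, g p ≠ 0 := by
    by_cases hloop : ∃ s r, inK s ∧ lam s r ∧ free s r
    · left
      obtain ⟨s, r, hs, h1, h2⟩ := hloop
      refine (Finset.sum_pos' (fun s _ => by split_ifs <;> norm_num) ⟨s, Finset.mem_univ s, ?_⟩).ne'
      rw [if_pos ⟨hs, r, h1, h2⟩]; norm_num
    · right
      obtain ⟨π, hπ, hne⟩ := hnz.resolve_right hloop
      refine ⟨π, by simp [P, hπ], ?_⟩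
      have hcount : ∀ ρ : D → D, ((({s | inK s ∧ lam s (ρ s)}.ncard : ℕ) : ℝ)) =
          ∑ s, if inK s then (if pure s (ρ s) then (1 : ℝ) else 0) else 0 := by
        intro ρ
        have : {s | inK s ∧ lam s (ρ s)} = ((Finset.univ.filter fun s => inK s ∧ lam s (ρ s) :
            Finset D) : Set D) := by ext; simp
        rw [this, Set.ncard_coe_finset, Finset.card_filter]
        push_cast
        refine Finset.sum_congr rfl fun s _ => ?_
        by_cases h1 : inK s <;> by_cases h2 : lam s (ρ s) <;> simp [h1, h2, pure]
        by_contra h3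
        exact hloop ⟨s, _, h1, h2, by tauto⟩
      have hg : g π = (({s | inK s ∧ lam s (π s)}.ncard : ℕ) : ℝ) -
          (({s | inK s ∧ lam s s}.ncard : ℕ) : ℝ) := by
        rw [hcount π, hcount fun s => s, ← Finset.sum_sub_distrib]
        refine Finset.sum_congr rfl fun s _ => ?_
        split_ifs <;> simp
      rw [hg, sub_ne_zero]
      exact_mod_cast hne
  obtain ⟨α, μ, hα, hμ, hS⟩ := exists_positive_weights P g N hcond
  -- Edges inside strong classes are weighted by a positive combination of permutation matrices,
  -- which balances row and column sums. Edges leaving a class get weight `1` through `c₂`; none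
  -- leaves the class of `s₀`.
  let c₁ : D → D → ℝ := fun r s => ∑ p ∈ P, α p * if p s = r then 1 else 0
  let c₂ : D → D → ℝ := fun r s => if H s r ∧ ¬ Relation.ReflTransGen H r s then 1 else 0
  let c : D → D → ℝ := fun r s => c₁ r s + c₂ r s
  let X : D → D → ℝ := fun r s => (if r = s then ∑ q, c q s else 0) - c r s
  have hc₁ : ∀ r s, 0 ≤ c₁ r s := fun r s =>
    Finset.sum_nonneg fun p _ => mul_nonneg (hα p).le (by split_ifs <;> norm_num)
  have hc₂ : ∀ r s, 0 ≤ c₂ r s := fun r s => by simp only [c₂]; split_ifs <;> norm_num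
  have hc : ∀ r s, 0 ≤ c r s := fun r s => add_nonneg (hc₁ r s) (hc₂ r s)
  have hcH : ∀ r s, H s r → 0 < c r s := by
    intro r s hsr
    by_cases hrs : Relation.ReflTransGen H r s
    · obtain ⟨π, hπ1, hπ2⟩ := exists_perm_of_reflTransGen hrs
      have hπP : π ∈ P := by
        simp only [P, Finset.mem_filter, Finset.mem_univ, true_and]
        intro x
        by_cases hx : x = s
        · rw [hx, hπ1]; exact hsr
        · rcases hπ2 x hx with h | h
          · rw [h]; exact hrefl x
          · exact h
      refine add_pos_of_pos_of_nonneg (Finset.sum_pos' (fun p _ => mul_nonneg (hα p).le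
        (by split_ifs <;> norm_num)) ⟨π, hπP, ?_⟩) (hc₂ r s)
      rw [if_pos hπ1, mul_one]; exact hα π
    · refine add_pos_of_nonneg_of_pos (hc₁ r s) ?_
      simp only [c₂]
      rw [if_pos ⟨hsr, hrs⟩]; norm_num
  have hcH' : ∀ r s, ¬ H s r → c r s = 0 := by
    intro r s hsr
    have h1 : c₁ r s = 0 := Finset.sum_eq_zero fun p hp => by
      rw [if_neg, mul_zero]
      rintro rfl
      simp only [P, Finset.mem_filter, Finset.mem_univ, true_and] at hp
      exact hsr (hp s)
    have h2 : c₂ r s = 0 := if_neg fun h => hsr h.1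
    simp only [c, h1, h2, add_zero]
  have hXoff : ∀ r s, r ≠ s → X r s = - c r s := fun r s h => by simp [X, h]
  have hcol : ∀ s, ∑ r, X r s = 0 := by
    intro s
    simp [X, Finset.sum_sub_distrib]
  -- closure of the class of `s₀`
  have hKcl : ∀ s r, inK s → H s r → inK r := fun s r hs h => hs.tail h
  have hKret : ∀ s r, inK s → Relation.ReflTransGen H r s := fun s r hs => (hreach r).trans hs
  have hPK : ∀ p ∈ P, ∀ s, inK (p s) ↔ inK s := by
    intro p hp
    simp only [P, Finset.mem_filter, Finset.mem_univ, true_and] at hp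
    have h1 : ∀ s, inK s → inK (p s) := fun s hs => hKcl _ _ hs (hp s)
    have h2 : (fun s => (p s)) '' {s | inK s} = {s | inK s} :=
      Set.eq_of_subset_of_ncard_le (by rintro _ ⟨s, hs, rfl⟩; exact h1 s hs)
        (by rw [Set.ncard_image_of_injective _ p.injective])
    refine fun s => ⟨fun hs => ?_, h1 s⟩
    obtain ⟨t, ht, hts⟩ : p s ∈ (fun s => (p s)) '' {s | inK s} := h2.symm ▸ hs
    rwa [← p.injective hts]
  have hXK : ∀ r s, inK s → X r s = ∑ p ∈ P, α p * ((if r = s then 1 else 0) -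
      if p s = r then 1 else 0) := by
    intro r s hs
    have h2 : ∀ r, c₂ r s = 0 := fun r => if_neg fun h => h.2 (hKret s r hs)
    have h3 : ∑ q, c q s = ∑ p ∈ P, α p := by
      simp only [c, h2, add_zero, c₁]
      rw [Finset.sum_comm]
      refine Finset.sum_congr rfl fun p _ => ?_
      simp
    have h4 : X r s = (if r = s then ∑ q, c q s else 0) - c r s := rfl
    rw [h4, h3]
    simp only [mul_sub, Finset.sum_sub_distrib, c, h2, add_zero, c₁]
    congr 1
    split_ifs <;> simp
  -- The permutations preserve the class of `s₀`, so the row sums over that class cancel; this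
  -- supplies the right null vector.
  have hrow : ∀ r, ∑ s, (if inK s then X r s else 0) = 0 := by
    intro r
    have h1 : ∀ s, (if inK s then X r s else 0) = ∑ p ∈ P, α p *
        ((if s = r then if inK r then 1 else 0 else 0) -
          if s = p.symm r then if inK r then 1 else 0 else 0) := by
      intro s
      by_cases hs : inK s
      · rw [if_pos hs, hXK r s hs]
        refine Finset.sum_congr rfl fun p hp => ?_
        congr 2
        · by_cases h : r = s
          · subst h; simp [hs]
          · simp [h, Ne.symm h]
        · by_cases h : p s = r
          · have : s = p.symm r := by rw [← h]; simp
            rw [if_pos h, if_pos this, if_pos (h ▸ (hPK p hp s).2 hs)]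
          · have : s ≠ p.symm r := fun h' => h (by rw [h']; simp)
            rw [if_neg h, if_neg this]
      · rw [if_neg hs]
        symm
        refine Finset.sum_eq_zero fun p hp => ?_
        have e1 : (if s = r then if inK r then (1 : ℝ) else 0 else 0) = 0 := by
          split_ifs with h h'
          · exact absurd (h ▸ h') hs
          · rfl
          · rfl
        have e2 : (if s = p.symm r then if inK r then (1 : ℝ) else 0 else 0) = 0 := by
          split_ifs with h h'
          · exact absurd ((hPK p hp s).1 (by rw [h]; simpa using h')) hs
          · rfl
          · rfl
        rw [e1, e2]; simp
    simp only [h1]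
    rw [Finset.sum_comm]
    refine Finset.sum_eq_zero fun p _ => ?_
    rw [← Finset.mul_sum, Finset.sum_sub_distrib]
    simp
  have hXpure : ∀ s r, pure s r → X r s ≠ 0 := by
    intro s r hsr
    by_cases hrs : r = s
    · subst hrs
      -- Without another out-neighbour, `r` would be `s₀` and its class a singleton. Then no
      -- permutation changes the count, and a free `λ`-entry there would contradict purity, so `hnz`
      -- would fail.
      have hout : ∃ q, q ≠ r ∧ H r q := by
        by_contra! hno
        have honly : ∀ t, Relation.ReflTransGen H r t → t = r := by
          intro t ht
          induction ht with
          | refl => rfl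
          | tail _ h ih =>
            subst ih
            by_contra hne
            exact hno _ hne h
        have hs₀ : s₀ = r := honly _ (hreach r)
        subst hs₀
        rcases hnz with ⟨π, hπ, hne⟩ | ⟨s, q, hs, h1, h2⟩
        · apply hne
          congr 1
          ext s
          refine and_congr_right fun hs => ?_
          rw [honly s hs, honly (π s₀) (Relation.ReflTransGen.single (hπ s₀))]
        · have := honly s hs
          subst this
          have := hfun _ _ _ h1 hsr.1
          subst this
          exact hsr.2 h2
      obtain ⟨q, hq, hrq⟩ := hout
      have h1 : X r r = ∑ q ∈ Finset.univ \ {r}, c q r := by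
        simp only [X, if_true]
        rw [Finset.sum_eq_add_sum_sdiff_singleton_of_mem (Finset.mem_univ r)]
        ring
      rw [h1]
      exact (Finset.sum_pos' (fun q _ => hc q r) ⟨q, by simpa using hq, hcH q r hrq⟩).ne'
    · rw [hXoff r s hrs]
      exact neg_ne_zero.2 (hcH r s (hlamH s r hsr.1)).ne'
  -- Dividing column `s` by `v s` normalizes its pure `λ`-entry to `-1`; columns without one may be
  -- scaled by any `μ ≠ 0`. Scaling columns preserves the left kernel.
  let v : D → ℝ := fun s => if h : ∃ r, pure s r then - X h.choose s else μ
  have hvpure : ∀ s r, pure s r → v s = - X r s := by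
    intro s r hsr
    have h : ∃ r, pure s r := ⟨r, hsr⟩
    simp only [v, dif_pos h]
    rw [hfun _ _ _ h.choose_spec.1 hsr.1]
  have hv : ∀ s, v s ≠ 0 := by
    intro s
    by_cases h : ∃ r, pure s r
    · obtain ⟨r, hr⟩ := h
      rw [hvpure s r hr]
      exact neg_ne_zero.2 (hXpure s r hr)
    · simp only [v, dif_neg h]; exact hμ
  let Z : Matrix D D ℂ := Matrix.of fun r s => ((X r s / v s : ℝ) : ℂ)
  let z : D → ℂ := fun s => if inK s then ((v s : ℝ) : ℂ) else 0
  have hker : ∀ w, w ᵥ* Z = 0 → ∀ r, w r = w s₀ := by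
    intro w hw
    refine eq_const_of_laplacian hreach hc hcH fun s => ?_
    have h1 : ∑ r, w r * ((X r s / v s : ℝ) : ℂ) = 0 := congrFun hw s
    have h2 : ∑ r, w r * ((X r s : ℝ) : ℂ) = 0 := by
      have h3 : ∑ r, w r * ((X r s / v s : ℝ) : ℂ) = (∑ r, w r * ((X r s : ℝ) : ℂ)) / (v s : ℝ) := by
        rw [Finset.sum_div]
        exact Finset.sum_congr rfl fun r _ => by push_cast; ring
      rw [h3, div_eq_zero_iff] at h1
      exact h1.resolve_right (by exact_mod_cast hv s)
    have h4 : ∀ r, w r * ((X r s : ℝ) : ℂ) = (if r = s then w s * ((∑ q, c q s : ℝ) : ℂ) else 0) -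
        w r * (c r s : ℝ) := by
      intro r
      simp only [X]
      by_cases h : r = s
      · subst h; simp; ring
      · simp [h]
    simp only [h4, Finset.sum_sub_distrib, Finset.sum_ite_eq', Finset.mem_univ, if_true] at h2
    exact sub_eq_zero.1 h2
  have hone : (fun _ => (1 : ℂ)) ᵥ* Z = 0 := by
    ext s
    change ∑ r, (1 : ℂ) * ((X r s / v s : ℝ) : ℂ) = 0
    simp only [one_mul]
    rw [← Complex.ofReal_sum, ← Finset.sum_div, hcol s]
    simp
  have hz : Z *ᵥ z = 0 := by
    ext r
    change ∑ s, ((X r s / v s : ℝ) : ℂ) * (if inK s then ((v s : ℝ) : ℂ) else 0) = 0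
    have : ∀ s, ((X r s / v s : ℝ) : ℂ) * (if inK s then ((v s : ℝ) : ℂ) else 0) =
        ((if inK s then X r s else 0 : ℝ) : ℂ) := by
      intro s
      split_ifs
      · rw [← Complex.ofReal_mul, div_mul_cancel₀ _ (hv s)]
      · simp
    simp only [this]
    rw [← Complex.ofReal_sum, hrow r]; simp
  have hz₀ : z s₀ ≠ 0 := by
    simp only [z, inK, Relation.ReflTransGen.refl, if_true]
    exact_mod_cast hv s₀
  refine ⟨Z, fun s r h => ?_, fun s r h1 h2 => ?_, ?_, ?_, ?_⟩
  · have hrs : r ≠ s := by rintro rfl; exact h (hrefl r)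
    simp [Z, hXoff r s hrs, hcH' r s h]
  · have h3 : pure s r := ⟨h1, h2⟩
    simp only [Z, Matrix.of_apply, hvpure s r h3, div_neg, div_self (hXpure s r h3)]
    simp
  · rw [← Matrix.exists_vecMul_eq_zero_iff]
    exact ⟨_, fun h => one_ne_zero (congrFun h s₀), hone⟩
  · exact adjugate_ne_zero_of_leftKernel hker hz hz₀
  · refine exists_det_sub_smul_ne_zero hker hz hz₀ ?_
    have hsum : ∑ r, ((Matrix.of fun r s => if lam s r then (1 : ℂ) else 0) *ᵥ z) r =
        ((∑ s, (if inK s then ∑ r, (if lam s r then v s else 0) else 0) : ℝ) : ℂ) := by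
      simp only [Matrix.mulVec, dotProduct, Matrix.of_apply, z]
      rw [Finset.sum_comm]
      push_cast
      refine Finset.sum_congr rfl fun s _ => ?_
      split_ifs
      · push_cast
        refine Finset.sum_congr rfl fun r _ => ?_
        split_ifs <;> simp
      · simp
    rw [hsum]
    -- In the class of `s₀`, a pure `λ`-column contributes its `-X`, that is, the weighted
    -- difference between permutations and the identity. A free `λ`-column contributes `μ`, and
    -- other columns nothing; the weights were chosen to make this total nonzero.
    have hcalc : ∑ s, (if inK s then ∑ r, (if lam s r then v s else 0) else 0) =
        ∑ p ∈ P, α p * g p + μ * N := by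
      simp only [g, N, Finset.mul_sum]
      rw [Finset.sum_comm, ← Finset.sum_add_distrib]
      refine Finset.sum_congr rfl fun s _ => ?_
      by_cases hs : inK s
      · simp only [hs, if_true, true_and]
        by_cases hl : ∃ r, lam s r
        · obtain ⟨r, hr⟩ := hl
          have hiff : ∀ q, lam s q ↔ q = r := fun q =>
            ⟨fun h => hfun s q r h hr, fun h => h ▸ hr⟩
          have e1 : ∑ q, (if lam s q then v s else 0) = v s := by simp [hiff]
          rw [e1]
          by_cases hf : free s r
          · have hnp : ∀ q, ¬ pure s q := fun q hq => hq.2 (((hiff q).1 hq.1) ▸ hf)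
            have hne : ¬ ∃ q, pure s q := fun ⟨q, hq⟩ => hnp q hq
            have h5 : ∃ r, lam s r ∧ free s r := ⟨r, hr, hf⟩
            simp [hnp, v, h5]
          · have hp : pure s r := ⟨hr, hf⟩
            have hpi : ∀ q, pure s q ↔ q = r := fun q =>
              ⟨fun h => (hiff q).1 h.1, fun h => h ▸ hp⟩
            have h5 : ¬ ∃ r, lam s r ∧ free s r := fun ⟨q, h1, h2⟩ => hf (((hiff q).1 h1) ▸ h2)
            rw [if_neg h5, mul_zero, add_zero, hvpure s r hp, hXK r s hs, ← Finset.sum_neg_distrib]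
            refine Finset.sum_congr rfl fun p _ => ?_
            simp only [hpi, eq_comm (a := r)]
            ring
        · have h4 : ∀ q, ¬ lam s q := fun q hq => hl ⟨q, hq⟩
          simp [h4, pure]
      · simp [hs]
    rw [hcalc]
    exact_mod_cast hS

end Laplacian

end StructControl

/-! ### Persistence of zeros; linkings as row injections. -/

namespace StructControl

open scoped Matrix

/-- Only one Leibniz term survives. This certifies that a polynomial determinant is nonzero at a
well-chosen point. -/
theorem det_ne_zero_of_unique_perm {D : Type} [Fintype D] [DecidableEq D] {Q : Matrix D D ℂ}
    (π : Equiv.Perm D) (hπ : ∀ s, Q (π s) s ≠ 0)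
    (huniq : ∀ ρ : Equiv.Perm D, (∀ s, Q (ρ s) s ≠ 0) → ρ = π) : Q.det ≠ 0 := by
  rw [Matrix.det_apply', Finset.sum_eq_single π]
  · exact mul_ne_zero (by simp) (Finset.prod_ne_zero_iff.2 fun s _ => hπ s)
  · intro ρ _ hne
    have : ∃ s, Q (ρ s) s = 0 := by
      by_contra! h
      exact hne (huniq ρ h)
    obtain ⟨s, hs⟩ := this
    have h0 : ∏ i, Q (ρ i) i = 0 := Finset.prod_eq_zero (Finset.mem_univ s) hs
    rw [h0, mul_zero]
  · simp

theorem exists_perm_of_det_ne_zero {D : Type} [Fintype D] [DecidableEq D] {Q : Matrix D D ℂ}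
    (h : Q.det ≠ 0) : ∃ π : Equiv.Perm D, ∀ s, Q (π s) s ≠ 0 := by
  rw [Matrix.det_apply'] at h
  obtain ⟨π, -, hπ⟩ := Finset.exists_ne_zero_of_sum_ne_zero h
  exact ⟨π, fun s => Finset.prod_ne_zero_iff.1 (right_ne_zero_of_mul hπ) s (Finset.mem_univ s)⟩

/-- Zeros of a continuous family of entire functions persist under small perturbations. -/
theorem eventually_exists_zero {T : Type} [TopologicalSpace T] {f g : ℂ × T → ℂ}
    (hf : Continuous f) (hg : Continuous g) (hd : ∀ t, Differentiable ℂ fun c => f (c, t))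
    {c₀ : ℂ} {t₀ : T} (hf₀ : f (c₀, t₀) = 0) (hg₀ : g (c₀, t₀) ≠ 0) (hne : ∃ c, f (c, t₀) ≠ 0) :
    ∀ᶠ t in nhds t₀, ∃ c, f (c, t) = 0 ∧ g (c, t) ≠ 0 := by
  have han : AnalyticOnNhd ℂ (fun c => f (c, t₀)) Set.univ :=
    (hd t₀).differentiableOn.analyticOnNhd isOpen_univ
  have hiso : ∀ᶠ c in nhdsWithin c₀ {c₀}ᶜ, f (c, t₀) ≠ 0 := by
    rcases (han c₀ trivial).eventually_eq_zero_or_eventually_ne_zero with h | h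
    · obtain ⟨c, hc⟩ := hne
      exact absurd (han.eqOn_zero_of_preconnected_of_eventuallyEq_zero isPreconnected_univ trivial h
        (trivial : c ∈ Set.univ)) hc
    · exact h
  have hgev : ∀ᶠ p in nhds (c₀, t₀), g p ≠ 0 := hg.continuousAt.eventually_ne hg₀
  rw [nhds_prod_eq, Filter.eventually_prod_iff] at hgev
  obtain ⟨p₁, hp₁, p₂, hp₂, hp⟩ := hgev
  rw [eventually_nhdsWithin_iff] at hiso
  -- The disc is small enough that `c₀` is the only zero of `f (·, t₀)` in it and that `g` stays
  -- nonzero over it for nearby `t`.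
  obtain ⟨r, hr, hball⟩ := Metric.nhds_basis_closedBall.eventually_iff.1 (hiso.and hp₁)
  have hsphere : ∀ c ∈ Metric.sphere c₀ r, f (c, t₀) ≠ 0 := fun c hc =>
    (hball (Metric.sphere_subset_closedBall hc)).1 (by
      rintro rfl
      simp at hc
      exact hr.ne hc)
  obtain ⟨c₁, hc₁, hmin⟩ := (isCompact_sphere c₀ r).exists_isMinOn
    (NormedSpace.sphere_nonempty.2 hr.le)
    (f := fun c => ‖f (c, t₀)‖) (by fun_prop)
  set m := ‖f (c₁, t₀)‖ with hm
  have hmpos : 0 < m := norm_pos_iff.2 (hsphere c₁ hc₁)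
  have hev : ∀ᶠ t in nhds t₀, ∀ c ∈ Metric.sphere c₀ r, m / 2 < ‖f (c, t) - f (c₀, t)‖ := by
    refine (isCompact_sphere c₀ r).eventually_forall_of_forall_eventually fun c hc => ?_
    have h1 : Continuous fun z : T × ℂ => ‖f (z.2, z.1) - f (c₀, z.1)‖ := by fun_prop
    refine h1.continuousAt.eventually_const_lt ?_
    have h2 : m ≤ ‖f (c, t₀)‖ := hmin hc
    simp only [hf₀, sub_zero]
    linarith
  have hev0 : ∀ᶠ t in nhds t₀, ‖f (c₀, t)‖ < m / 4 := by
    have h1 : Continuous fun t : T => ‖f (c₀, t)‖ := by fun_prop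
    refine h1.continuousAt.eventually_lt_const ?_
    simp only [hf₀, norm_zero]
    linarith
  filter_upwards [hev, hev0, hp₂] with t h1 h2 h3
  have hfreq : ∃ᶠ z in nhds c₀, f (z, t) ≠ f (c₀, t) := by
    by_contra hnot
    rw [Filter.not_frequently] at hnot
    have hnot' : ∀ᶠ z in nhds c₀, f (z, t) = f (c₀, t) := by simpa using hnot
    have han' : AnalyticOnNhd ℂ (fun c => f (c, t)) Set.univ :=
      (hd t).differentiableOn.analyticOnNhd isOpen_univ
    have := han'.eqOn_of_preconnected_of_eventuallyEq (analyticOnNhd_const (v := f (c₀, t)))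
      isPreconnected_univ (Set.mem_univ c₀) hnot' (Set.mem_univ c₁)
    have h4 := h1 c₁ hc₁
    simp only at this
    rw [this, sub_self, norm_zero] at h4
    linarith
  -- Quantitative open mapping: the image of the disc contains the ball of radius `m / 4` about `f
  -- (c₀, t)`, and `‖f (c₀, t)‖ < m / 4` puts `0` inside it.
  have hsub := DiffContOnCl.ball_subset_image_closedBall (f := fun c => f (c, t)) (z₀ := c₀)
    (r := r) (ε := m / 2) (hd t).diffContOnCl hr (fun z hz => (h1 z hz).le) hfreq
  have h0 : (0 : ℂ) ∈ Metric.ball (f (c₀, t)) (m / 2 / 2) := by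
    rw [Metric.mem_ball, dist_comm, dist_zero_right]
    linarith
  obtain ⟨c, hc, hc0⟩ := hsub h0
  exact ⟨c, hc0, hp (hball hc).2 h3⟩

section Linkings

variable {V : Type} {n : ℕ} {G : Digraph V} {R : Set (Fin n)} {f g : Fin n → V}
  {Ent : Fin n → Fin n → Prop}

/-- Heads are distinct and lie over `R`; a linking of full size therefore assigns to every row of
`R` its own column. The general `f`, `g` and `R` serve both the system graph and the split graph,
with or without the edges into `i`. -/
theorem IsLinking.ncard_le_and_exists (hg : Function.Injective g)
    (hG : ∀ a v, G.Adj a v ↔ ∃ r ∈ R, ∃ s, Ent r s ∧ a = f s ∧ v = g r) {E : Set (V × V)}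
    (hE : IsLinking G E) :
    E.ncard ≤ R.ncard ∧ (E.ncard = R.ncard → ∃ ρ : Fin n → Fin n, Set.InjOn ρ R ∧
      (∀ r ∈ R, Ent r (ρ r)) ∧ E = (fun r => (f (ρ r), g r)) '' R) := by
  have hsub : Prod.snd '' E ⊆ g '' R := by
    rintro _ ⟨e, he, rfl⟩
    obtain ⟨r, hr, s, -, -, h⟩ := (hG _ _).1 (hE.adj e he)
    exact ⟨r, hr, h.symm⟩
  have hfin : (g '' R).Finite := Set.toFinite _
  have h1 : (Prod.snd '' E).ncard = E.ncard := Set.InjOn.ncard_image hE.injSnd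
  have h2 : (g '' R).ncard = R.ncard := Set.ncard_image_of_injective _ hg
  refine ⟨h1 ▸ h2 ▸ Set.ncard_le_ncard hsub hfin, fun hcard => ?_⟩
  have heq := Set.eq_of_subset_of_ncard_le hsub (by rw [h1, h2, hcard]) hfin
  have hex : ∀ r ∈ R, ∃ s, Ent r s ∧ (f s, g r) ∈ E := by
    intro r hr
    obtain ⟨e, he, her⟩ : g r ∈ Prod.snd '' E := heq ▸ ⟨r, hr, rfl⟩
    obtain ⟨r', hr', s, hs, h3, h4⟩ := (hG _ _).1 (hE.adj e he)
    have : r' = r := hg (h4.symm.trans her)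
    subst this
    exact ⟨s, hs, by rw [← h3, ← h4]; exact he⟩
  choose! ρ hρ hρE using hex
  refine ⟨ρ, fun r hr s hs hrs => ?_, hρ, ?_⟩
  · have := hE.injFst (hρE r hr) (hρE s hs) (by simp [hrs])
    exact hg (congrArg Prod.snd this)
  · ext e
    constructor
    · intro he
      obtain ⟨r, hr, s, -, -, h4⟩ := (hG _ _).1 (hE.adj e he)
      exact ⟨r, hr, hE.injSnd (hρE r hr) he h4.symm⟩
    · rintro ⟨r, hr, rfl⟩
      exact hρE r hr

theorem isLinking_image (hf : Function.Injective f) (hg : Function.Injective g)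
    (hG : ∀ a v, G.Adj a v ↔ ∃ r ∈ R, ∃ s, Ent r s ∧ a = f s ∧ v = g r) {ρ : Fin n → Fin n}
    (hρ : Set.InjOn ρ R) (hEnt : ∀ r ∈ R, Ent r (ρ r)) :
    IsLinking G ((fun r => (f (ρ r), g r)) '' R) ∧
      ((fun r => (f (ρ r), g r)) '' R).ncard = R.ncard := by
  refine ⟨⟨?_, ?_, ?_⟩, Set.ncard_image_of_injective _ fun r s h => hg (congrArg Prod.snd h)⟩
  · rintro _ ⟨r, hr, rfl⟩
    exact (hG _ _).2 ⟨r, hr, _, hEnt r hr, rfl, rfl⟩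
  · rintro _ ⟨r, hr, rfl⟩ _ ⟨s, hs, rfl⟩ h
    have : r = s := hρ hr hs (hf h)
    rw [this]
  · rintro _ ⟨r, hr, rfl⟩ _ ⟨s, hs, rfl⟩ h
    have : r = s := hg h
    rw [this]

end Linkings

end StructControl

/-! ### Generic behaviour of the reduced pencil and its diagonal blocks. -/

namespace StructControl

open scoped Matrix

variable {n : ℕ} {A : StructuredMatrix (Fin n) (Fin n)} {b : StructuredMatrix (Fin n) (Fin 1)}
  {F : StructuredMatrix (Fin n) (Fin n ⊕ Fin 1)} {i : Fin n}
  {j : Fin n ⊕ Fin 1} {τ : Fin n → Fin n ⊕ Fin 1}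

theorem isPoly_realize {p q : Type} (S : StructuredMatrix p q) (r : p) (u : q) :
    IsPoly fun t => realize S t r u := by
  by_cases h : S r u = true
  · simpa [realize, h] using IsPoly.coord (⟨(r, u), h⟩ : FreeEntry S)
  · simpa [realize, h] using IsPoly.const 0

theorem realize_of_false {p q : Type} {S : StructuredMatrix p q} {r : p} {u : q}
    (h : ¬ S r u = true) (t : FreeEntry S → ℂ) : realize S t r u = 0 := by
  simp [realize, h]

theorem realize_of_true {p q : Type} {S : StructuredMatrix p q} {r : p} {u : q}
    (h : S r u = true) (t : FreeEntry S → ℂ) : realize S t r u = t ⟨(r, u), h⟩ := by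
  simp [realize, h]

/-- The Kalman determinant is polynomial in the parameters and nonzero at the given controllable
realization. -/
theorem ae_controllable (hsc : StructurallyControllable A b) :
    ∀ᵐ t : FreeEntry (hcat A b) → ℂ, Controllable (realize (hcat A b) t) := by
  obtain ⟨M, hM, hc⟩ := hsc
  let t₁ : FreeEntry (hcat A b) → ℂ := fun e => M e.1.1 e.1.2
  have ht₁ : realize (hcat A b) t₁ = M := by
    ext r u
    by_cases h : hcat A b r u = true
    · rw [realize_of_true h]
    · rw [realize_of_false h, hM r u (by simpa using h)]
  have hpoly : IsPoly fun t : FreeEntry (hcat A b) → ℂ =>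
      (Matrix.of fun r k : Fin n => ((realize (hcat A b) t).toCols₁ ^ (k : ℕ) *
        (realize (hcat A b) t).toCols₂) r 0).det := by
    have hpow : ∀ k : ℕ, ∀ r u, IsPoly fun t : FreeEntry (hcat A b) → ℂ =>
        ((realize (hcat A b) t).toCols₁ ^ k) r u := by
      intro k
      induction k with
      | zero => intro r u; simpa using IsPoly.const _
      | succ k ih =>
        intro r u
        simp only [pow_succ]
        exact IsPoly.matrix_mul ih (fun r s => isPoly_realize _ r (Sum.inl s)) r u
    exact IsPoly.det fun r k =>
      IsPoly.matrix_mul (hpow k) (fun r s => isPoly_realize _ r (Sum.inr s)) r 0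
  filter_upwards [hpoly.ae_ne_zero (t₁ := t₁) (by
    rw [ht₁]; exact (controllable_iff_det M).1 hc)] with t ht
  exact (controllable_iff_det _).2 ht

/-- The pencil `[A - c I, b]` of a realization, restricted to the columns chosen by `τ`. -/
def reducedPencil (A : StructuredMatrix (Fin n) (Fin n)) (b : StructuredMatrix (Fin n) (Fin 1))
    (τ : Fin n → Fin n ⊕ Fin 1) (c : ℂ) (t : FreeEntry (hcat A b) → ℂ) :
    Matrix (Fin n) (Fin n) ℂ :=
  Matrix.of fun r s => realize (hcat A b) t r (τ s) - if τ s = Sum.inl r then c else 0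

theorem reducedPencil_eq_zero {r s : Fin n} (h : ¬ Step A b τ s r) (c : ℂ)
    (t : FreeEntry (hcat A b) → ℂ) : reducedPencil A b τ c t r s = 0 := by
  rw [Step, PencilEntry, not_or] at h
  simp [reducedPencil, realize_of_false h.1, h.2]

theorem isPoly_reducedPencil (c : ℂ) (r s : Fin n) :
    IsPoly fun t => reducedPencil A b τ c t r s := by
  have := (isPoly_realize (hcat A b) r (τ s)).add
    (IsPoly.const (- if τ s = Sum.inl r then c else 0))
  simpa [reducedPencil, sub_eq_add_neg] using this

/-- A controllable realization can be made uncontrollable by changing entry `(i, j)` if and only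
if some left null vector of the pencil without column `j` does not vanish at `i`. -/
theorem not_ptc_iff (h : IsTransversal A b j τ) (hF : ∀ k l, F k l = true ↔ k = i ∧ l = j)
    {t : FreeEntry (hcat A b) → ℂ} (hc : Controllable (realize (hcat A b) t)) :
    ¬ PTC (realize (hcat A b) t) F ↔
      ∃ (c : ℂ) (w : Fin n → ℂ), w ᵥ* reducedPencil A b τ c t = 0 ∧ w i ≠ 0 := by
  constructor
  · intro hp
    rw [PTC] at hp
    push Not at hp
    obtain ⟨D, hD, hn⟩ := hp
    rw [controllable_iff_pbh] at hn
    push Not at hn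
    obtain ⟨c, w, hw, hne⟩ := hn
    refine ⟨c, w, ?_, ?_⟩
    · ext s
      have h1 := hw (τ s)
      have h2 : ∀ r, D r (τ s) = 0 := fun r => hD r _ (by
        by_contra h3
        exact h.ne s ((hF r (τ s)).1 (by simpa using h3)).2)
      simpa [Matrix.vecMul, dotProduct, reducedPencil, h2] using h1
    · intro hwi
      refine hne ((controllable_iff_pbh _).1 hc c w fun u => ?_)
      refine Eq.trans ?_ (hw u)
      refine Finset.sum_congr rfl fun r _ => ?_
      by_cases hr : r = i
      · subst hr; rw [hwi]; ring
      · have : D r u = 0 := hD r _ (by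
          by_contra h3
          exact hr ((hF r u).1 (by simpa using h3)).1)
        rw [Matrix.add_apply, this, add_zero]
  · rintro ⟨c, w, hw, hwi⟩ hp
    -- This value of the perturbation makes `w` annihilate column `j`; `w i ≠ 0` allows the
    -- division.
    let d : ℂ := - (∑ r, w r * (realize (hcat A b) t r j - if j = Sum.inl r then c else 0)) / w i
    have := hp (Matrix.single i j d) (by
      intro k l hkl
      rw [Matrix.single_apply, if_neg]
      rintro ⟨rfl, rfl⟩
      have := (hF i j).2 ⟨rfl, rfl⟩
      rw [hkl] at this
      exact absurd this (by simp))
    rw [controllable_iff_pbh] at this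
    refine hwi (congrFun (this c w fun u => ?_) i)
    by_cases hu : u = j
    · subst hu
      have h1 : ∀ r, w r * ((realize (hcat A b) t + Matrix.single i u d) r u -
          if u = Sum.inl r then c else 0) =
          w r * (realize (hcat A b) t r u - if u = Sum.inl r then c else 0) +
            if r = i then w i * d else 0 := by
        intro r
        by_cases hr : r = i
        · subst hr; simp; ring
        · simp [hr, Ne.symm hr]
      simp only [h1, Finset.sum_add_distrib, Finset.sum_ite_eq', Finset.mem_univ, if_true, d]
      field_simp
      ring
    · obtain ⟨s, rfl⟩ := h.surj hu
      have h1 := congrFun hw s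
      have h2 : ∀ r, Matrix.single i j d r (τ s) = 0 := fun r => by
        rw [Matrix.single_apply, if_neg]
        rintro ⟨-, h3⟩
        exact h.ne s h3.symm
      simpa [Matrix.vecMul, dotProduct, reducedPencil, h2] using h1

/-- An open set of realizations with suitable left null vectors prevents perturbation tolerance. -/
theorem not_ptsc_of_eventually (h : IsTransversal A b j τ)
    (hF : ∀ k l, F k l = true ↔ k = i ∧ l = j) (hsc : StructurallyControllable A b)
    {t₀ : FreeEntry (hcat A b) → ℂ} (hev : ∀ᶠ t in nhds t₀, ∃ (c : ℂ) (w : Fin n → ℂ),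
      w ᵥ* reducedPencil A b τ c t = 0 ∧ w i ≠ 0) : ¬ PTSC A b F := by
  intro hp
  obtain ⟨S, hS, hopen, hmem⟩ := eventually_nhds_iff.1 hev
  have hae : ∀ᵐ t : FreeEntry (hcat A b) → ℂ, t ∉ S := by
    filter_upwards [hp, ae_controllable hsc] with t h1 h2 htS
    exact (not_ptc_iff h hF h2).2 (hS t htS) (h1 h2)
  have hzero : volume S = 0 := by
    rw [ae_iff] at hae
    simpa using hae
  exact (hopen.measure_pos volume ⟨t₀, hmem⟩).ne' hzero

/-- For almost all realizations, `[A, b]` without column `j` is nonsingular if its pattern has a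
perfect matching. -/
theorem ae_det_reducedPencil_zero_ne_zero (h : IsTransversal A b j τ) {π : Equiv.Perm (Fin n)}
    (hπ : ∀ s, hcat A b (π s) (τ s) = true) :
    ∀ᵐ t : FreeEntry (hcat A b) → ℂ, (reducedPencil A b τ 0 t).det ≠ 0 := by
  classical
  let t₁ : FreeEntry (hcat A b) → ℂ := fun e => if ∃ s, e.1 = (π s, τ s) then 1 else 0
  refine (IsPoly.det fun r s => isPoly_reducedPencil 0 r s).ae_ne_zero (t₁ := t₁) ?_
  refine det_ne_zero_of_unique_perm π (fun s => ?_) fun ρ hρ => ?_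
  · simp [reducedPencil, realize_of_true (hπ s), t₁, h.inj.eq_iff]
  · ext s : 1
    have h1 := hρ s
    by_contra hne
    refine h1 ?_
    by_cases h2 : hcat A b (ρ s) (τ s) = true
    · simp only [reducedPencil, Matrix.of_apply, ite_self, sub_zero, realize_of_true h2, t₁]
      rw [if_neg]
      rintro ⟨s', hs'⟩
      rw [Prod.mk.injEq] at hs'
      exact hne (hs'.1.trans (congrArg π (h.inj hs'.2).symm))
    · simp [reducedPencil, realize_of_false h2]

/-- The diagonal block of `Q` on `K`, completed by the identity. -/
noncomputable def diagBlock (K : Set (Fin n)) (Q : Matrix (Fin n) (Fin n) ℂ) :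
    Matrix (Fin n) (Fin n) ℂ :=
  open Classical in Matrix.of fun r s => if r ∈ K ∧ s ∈ K then Q r s else if r = s then 1 else 0

theorem diagBlock_apply_mem {K : Set (Fin n)} {Q : Matrix (Fin n) (Fin n) ℂ} {r s : Fin n}
    (hr : r ∈ K) (hs : s ∈ K) : diagBlock K Q r s = Q r s := by
  simp [diagBlock, hr, hs]

theorem diagBlock_apply_notMem {K : Set (Fin n)} {Q : Matrix (Fin n) (Fin n) ℂ} {r s : Fin n}
    (h : ¬ (r ∈ K ∧ s ∈ K)) : diagBlock K Q r s = if r = s then 1 else 0 := by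
  simp only [diagBlock, Matrix.of_apply, if_neg h]

/-- Outside the block the matrix is the identity, so a surviving Leibniz term can move points only
within `K`. -/
theorem IsClassPerm.of_forall_ne_zero {K : Set (Fin n)} {c : ℂ} {t : FreeEntry (hcat A b) → ℂ}
    {π : Equiv.Perm (Fin n)} (hπ : ∀ s, diagBlock K (reducedPencil A b τ c t) (π s) s ≠ 0) :
    IsClassPerm A b τ K π := by
  have hmem : ∀ s ∈ K, π s ∈ K := by
    intro s hs
    by_contra hns
    have h1 := hπ s
    rw [diagBlock_apply_notMem (fun h => hns h.1)] at h1
    have : π s = s := by by_contra h; exact h1 (if_neg h)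
    exact hns (this.symm ▸ hs)
  refine ⟨fun s hs => ?_, hmem, fun s hs => ?_⟩
  · have h1 := hπ s
    rw [diagBlock_apply_notMem (fun h => hs h.2)] at h1
    by_contra h; exact h1 (if_neg h)
  · by_contra hst
    exact hπ s (by rw [diagBlock_apply_mem (hmem s hs) hs, reducedPencil_eq_zero hst])

/-- Each surviving Leibniz term contains the same number of `λ`-entries, each equal to `-c` because
there are no self-loops, and its other factors do not involve `c`. -/
theorem det_diagBlock_eq (h : IsTransversal A b j τ) {K : Set (Fin n)}
    (hK : ¬ GammaNz A b (splitClass τ K)) (c : ℂ) (t : FreeEntry (hcat A b) → ℂ) :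
    (diagBlock K (reducedPencil A b τ c t)).det =
      c ^ lambdaCount τ K 1 * (diagBlock K (reducedPencil A b τ 1 t)).det := by
  classical
  rw [h.gammaNz_iff] at hK
  push Not at hK
  obtain ⟨hcount, hloop⟩ := hK
  rw [Matrix.det_apply', Matrix.det_apply', Finset.mul_sum]
  refine Finset.sum_congr rfl fun π _ => ?_
  have key : ∏ s, diagBlock K (reducedPencil A b τ c t) (π s) s =
      c ^ lambdaCount τ K 1 * ∏ s, diagBlock K (reducedPencil A b τ 1 t) (π s) s := by
    by_cases hπ : IsClassPerm A b τ K π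
    · rw [← hcount π hπ]
      have h1 : c ^ lambdaCount τ K π = ∏ s, if s ∈ K ∧ τ s = Sum.inl (π s) then c else 1 := by
        rw [Finset.prod_ite, Finset.prod_const_one, mul_one, Finset.prod_const, lambdaCount]
        congr 1
        rw [← Set.ncard_coe_finset]
        congr 1
        ext; simp
      rw [h1, ← Finset.prod_mul_distrib]
      refine Finset.prod_congr rfl fun s _ => ?_
      by_cases hs : s ∈ K
      · rw [diagBlock_apply_mem (hπ.mem s hs) hs, diagBlock_apply_mem (hπ.mem s hs) hs]
        by_cases hl : τ s = Sum.inl (π s)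
        · have hA := hloop s hs (π s) (hπ.mem s hs) hl
          have h2 : ¬ hcat A b (π s) (τ s) = true := by rw [hl]; exact hA
          rw [reducedPencil, reducedPencil, Matrix.of_apply, Matrix.of_apply, if_pos hl, if_pos hl,
            if_pos ⟨hs, hl⟩, realize_of_false h2]
          ring
        · simp [reducedPencil, hl]
      · rw [diagBlock_apply_notMem (fun h => hs h.2), diagBlock_apply_notMem (fun h => hs h.2)]
        simp [hs]
    · have h1 : ∀ c, ∏ s, diagBlock K (reducedPencil A b τ c t) (π s) s = 0 := by
        intro c
        by_contra hne
        exact hπ (IsClassPerm.of_forall_ne_zero fun s =>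
          Finset.prod_ne_zero_iff.1 hne s (Finset.mem_univ s))
      rw [h1, h1, mul_zero]
  rw [key]
  ring

/-- Set the free transversal entries to `1` and the other parameters to `0`. A surviving permutation
then moves points only along `λ`-entries, and meets every `λ`-entry of the identity; since the
counts agree, it meets no others and so moves nothing. -/
theorem ae_det_diagBlock_ne_zero (h : IsTransversal A b j τ) {K : Set (Fin n)}
    (hK : ¬ GammaNz A b (splitClass τ K)) :
    ∀ᵐ t : FreeEntry (hcat A b) → ℂ, (diagBlock K (reducedPencil A b τ 1 t)).det ≠ 0 := by
  classical
  rw [h.gammaNz_iff] at hK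
  push Not at hK
  obtain ⟨hcount, hloop⟩ := hK
  let t₁ : FreeEntry (hcat A b) → ℂ := fun e => if ∃ s, e.1 = (s, τ s) then 1 else 0
  refine (IsPoly.det fun r s => ?_).ae_ne_zero (t₁ := t₁) ?_
  · by_cases hrs : r ∈ K ∧ s ∈ K
    · simpa only [diagBlock_apply_mem hrs.1 hrs.2] using isPoly_reducedPencil 1 r s
    · simpa only [diagBlock_apply_notMem hrs] using IsPoly.const _
  refine det_ne_zero_of_unique_perm 1 (fun s => ?_) fun ρ hρ => ?_
  · rw [Equiv.Perm.one_apply]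
    by_cases hs : s ∈ K
    · rw [diagBlock_apply_mem hs hs, reducedPencil, Matrix.of_apply]
      by_cases hl : τ s = Sum.inl s
      · have h2 : ¬ hcat A b s (τ s) = true := by rw [hl]; exact hloop s hs s hs hl
        rw [realize_of_false h2, if_pos hl]
        simp
      · have h2 : hcat A b s (τ s) = true := (h.entry s).resolve_right hl
        simp [realize_of_true h2, hl, t₁]
    · rw [diagBlock_apply_notMem (fun h => hs h.2)]; simp
  · have hcl := IsClassPerm.of_forall_ne_zero hρ
    have hstep : ∀ s ∈ K, ρ s ≠ s → τ s = Sum.inl (ρ s) := by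
      intro s hs hne
      by_contra hl
      refine hρ s ?_
      rw [diagBlock_apply_mem (hcl.mem s hs) hs, reducedPencil, Matrix.of_apply, if_neg hl,
        sub_zero]
      by_cases h2 : hcat A b (ρ s) (τ s) = true
      · rw [realize_of_true h2]
        simp only [t₁]
        rw [if_neg]
        rintro ⟨s', hs'⟩
        rw [Prod.mk.injEq] at hs'
        exact hne (hs'.1.trans (h.inj hs'.2).symm)
      · rw [realize_of_false h2]
    have hsub : {s | s ∈ K ∧ τ s = Sum.inl ((1 : Equiv.Perm (Fin n)) s)} ⊆
        {s | s ∈ K ∧ τ s = Sum.inl (ρ s)} := by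
      rintro s ⟨hs, hl⟩
      refine ⟨hs, ?_⟩
      by_contra hl'
      exact hl' (hstep s hs fun h3 => hl' (by rw [h3]; exact hl))
    have heq := Set.eq_of_subset_of_ncard_le hsub (hcount ρ hcl).le
    ext s : 1
    by_contra hne
    by_cases hs : s ∈ K
    · have h1 : s ∈ {s | s ∈ K ∧ τ s = Sum.inl (ρ s)} := ⟨hs, hstep s hs hne⟩
      rw [← heq] at h1
      have h2 := (hstep s hs hne).symm.trans h1.2
      exact hne (by simpa using h2)
    · exact hne (hcl.fix s hs)

end StructControl

/-! ### Graph conditions in terms of `τ`; necessity; the case `c = 0`. -/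

namespace StructControl

open scoped Matrix

variable {n : ℕ} {A : StructuredMatrix (Fin n) (Fin n)} {b : StructuredMatrix (Fin n) (Fin 1)}
  {F : StructuredMatrix (Fin n) (Fin n ⊕ Fin 1)} {i : Fin n}
  {j : Fin n ⊕ Fin 1} {τ : Fin n → Fin n ⊕ Fin 1}

theorem ncard_compl_singleton_fin (i : Fin n) : ({i}ᶜ : Set (Fin n)).ncard = n - 1 := by
  rw [Set.ncard_compl]; simp

theorem IsTransversal.systemGraph_delete_adj_iff (h : IsTransversal A b j τ)
    (a v : Fin n ⊕ Fin 1) :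
    (deleteEdges (systemGraph A b) (outEdges (systemGraph A b) j)).Adj a v ↔
      ∃ r ∈ (Set.univ : Set (Fin n)), ∃ s, hcat A b r (τ s) = true ∧ a = τ s ∧ v = Sum.inl r := by
  constructor
  · rintro ⟨⟨r, rfl, hr⟩, h2⟩
    have ha : a ≠ j := fun h3 => h2 ⟨⟨r, rfl, hr⟩, h3⟩
    obtain ⟨s, rfl⟩ := h.surj ha
    exact ⟨r, trivial, s, hr, rfl, rfl⟩
  · rintro ⟨r, -, s, hr, rfl, rfl⟩
    exact ⟨⟨r, rfl, hr⟩, fun h2 => h.ne s h2.2⟩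

theorem IsTransversal.systemGraph_delete_adj_iff' (h : IsTransversal A b j τ)
    (a v : Fin n ⊕ Fin 1) :
    (deleteEdges (systemGraph A b) (outEdges (systemGraph A b) j ∪
      inEdges (systemGraph A b) (Sum.inl i))).Adj a v ↔
      ∃ r ∈ ({i}ᶜ : Set (Fin n)), ∃ s, hcat A b r (τ s) = true ∧ a = τ s ∧ v = Sum.inl r := by
  constructor
  · rintro ⟨⟨r, rfl, hr⟩, h2⟩
    have ha : a ≠ j := fun h3 => h2 (Or.inl ⟨⟨r, rfl, hr⟩, h3⟩)
    obtain ⟨s, rfl⟩ := h.surj ha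
    exact ⟨r, fun h3 => h2 (Or.inr ⟨⟨r, rfl, hr⟩, congrArg Sum.inl h3⟩), s, hr, rfl, rfl⟩
  · rintro ⟨r, hri, s, hr, rfl, rfl⟩
    refine ⟨⟨r, rfl, hr⟩, ?_⟩
    rintro (h2 | h2)
    · exact h.ne s h2.2
    · exact hri (by simpa using h2.2)

theorem IsTransversal.splitGraph_delete_adj_iff (h : IsTransversal A b j τ)
    (a v : (Fin n ⊕ Fin 1) ⊕ (Fin n ⊕ Fin 1)) :
    (deleteEdges (splitGraph A b) (outEdges (splitGraph A b) (outCopy j) ∪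
      inEdges (splitGraph A b) (inCopy (Sum.inl i)))).Adj a v ↔
      ∃ r ∈ ({i}ᶜ : Set (Fin n)), ∃ s, Step A b τ s r ∧ a = outCopy (τ s) ∧
        v = inCopy (Sum.inl r) := by
  constructor
  · rintro ⟨h1, h2⟩
    obtain ⟨u, r, rfl, rfl, hp⟩ := (splitGraph_adj_iff _ _ _ _).1 h1
    have ha : u ≠ j := fun h3 => h2 (Or.inl ⟨h1, congrArg outCopy h3⟩)
    obtain ⟨s, rfl⟩ := h.surj ha
    exact ⟨r, fun h3 => h2 (Or.inr ⟨h1, congrArg (fun r => inCopy (Sum.inl r)) h3⟩), s, hp, rfl,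
      rfl⟩
  · rintro ⟨r, hri, s, hp, rfl, rfl⟩
    refine ⟨(splitGraph_adj_iff _ _ _ _).2 ⟨_, r, rfl, rfl, hp⟩, ?_⟩
    rintro (h2 | h2)
    · exact h.ne s (by simpa using h2.2)
    · exact hri (by simpa using h2.2)

/-- Path-cycle families match rows with columns other than `j`. A family of size `n` would be a full
matching; one of size `n - 1` avoiding the edges into `i` matches every other row, and this is the
largest size possible there. -/
theorem IsTransversal.maxPathCycle_iff (h : IsTransversal A b j τ) :
    (IsMaxPathCycleFamilySize
        (deleteEdges (systemGraph A b) (outEdges (systemGraph A b) j)) (n - 1) ∧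
      IsMaxPathCycleFamilySize
        (deleteEdges (systemGraph A b)
          (outEdges (systemGraph A b) j ∪ inEdges (systemGraph A b) (Sum.inl i))) (n - 1)) ↔
      (¬ ∃ π : Equiv.Perm (Fin n), ∀ s, hcat A b (π s) (τ s) = true) ∧
        ∃ ρ : Fin n → Fin n, Set.InjOn ρ {i}ᶜ ∧ ∀ r ∈ ({i}ᶜ : Set (Fin n)),
          hcat A b r (τ (ρ r)) = true := by
  have hn : 0 < n := i.pos
  constructor
  · rintro ⟨⟨-, h1⟩, ⟨⟨E, hE, hcard⟩, -⟩⟩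
    constructor
    · rintro ⟨π, hπ⟩
      obtain ⟨h2, h3⟩ := isLinking_image h.inj Sum.inl_injective h.systemGraph_delete_adj_iff
        (ρ := π.symm) (π.symm.injective.injOn) (fun r _ => by simpa using hπ (π.symm r))
      have := h1 ⟨_, h2.isPathCycleFamily, rfl⟩
      rw [h3, Set.ncard_univ, Nat.card_eq_fintype_card, Fintype.card_fin] at this
      omega
    · have := (hE.isLinking.ncard_le_and_exists Sum.inl_injective
        h.systemGraph_delete_adj_iff').2 (by rw [hcard, ncard_compl_singleton_fin])
      obtain ⟨ρ, h2, h3, -⟩ := this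
      exact ⟨ρ, h2, h3⟩
  · rintro ⟨hno, ρ, hinj, hρ⟩
    obtain ⟨h2, h3⟩ := isLinking_image h.inj Sum.inl_injective h.systemGraph_delete_adj_iff'
      hinj hρ
    rw [ncard_compl_singleton_fin] at h3
    refine ⟨⟨⟨_, IsLinking.isPathCycleFamily ⟨fun e he => ?_, h2.injFst, h2.injSnd⟩, h3⟩, ?_⟩,
      ⟨⟨_, h2.isPathCycleFamily, h3⟩, ?_⟩⟩
    · obtain ⟨h4, h5⟩ := h2.adj e he
      exact ⟨h4, fun h6 => h5 (Or.inl h6)⟩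
    · rintro k ⟨E, hE, rfl⟩
      obtain ⟨h4, h5⟩ := hE.isLinking.ncard_le_and_exists Sum.inl_injective
        h.systemGraph_delete_adj_iff
      have huniv : (Set.univ : Set (Fin n)).ncard = n := by
        rw [Set.ncard_univ, Nat.card_eq_fintype_card, Fintype.card_fin]
      rw [huniv] at h4 h5
      have hne : E.ncard ≠ n := by
        intro heq
        obtain ⟨σ, hσ, hσ', -⟩ := h5 heq
        let π : Equiv.Perm (Fin n) := Equiv.ofBijective σ
          (Finite.injective_iff_bijective.1 (Set.injOn_univ.1 hσ))
        refine hno ⟨π.symm, fun s => ?_⟩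
        have h6 := hσ' (π.symm s) trivial
        rwa [show σ (π.symm s) = s from π.apply_symm_apply s] at h6
      omega
    · rintro k ⟨E, hE, rfl⟩
      rw [← ncard_compl_singleton_fin i]
      exact (hE.isLinking.ncard_le_and_exists Sum.inl_injective
        h.systemGraph_delete_adj_iff').1

theorem IsTransversal.exists_deficient_pathFamily_iff (h : IsTransversal A b j τ) :
    (∃ M', IsPathFamily
        (deleteEdges (splitGraph A b)
          (outEdges (splitGraph A b) (outCopy j) ∪
            inEdges (splitGraph A b) (inCopy (Sum.inl i)))) M' ∧
      M'.ncard = n - 1 ∧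
      ∃ C, IsComponent A b j (Set.range fun r => splitEdge (τ r) r) C ∧ GammaNz A b C ∧
        (M' ∩ inducedEdges (splitGraph A b) C).ncard + 1 ≤
          {u : Fin n ⊕ Fin 1 | outCopy u ∈ C}.ncard) ↔
      ∃ s, Relation.ReflTransGen (Step A b τ) i s ∧
        GammaNz A b (splitClass τ (stepClass A b τ s)) := by
  have hinjIn : Function.Injective fun r : Fin n =>
      (inCopy (Sum.inl r) : (Fin n ⊕ Fin 1) ⊕ (Fin n ⊕ Fin 1)) := fun r s h => by simpa using h
  have hinjOut : Function.Injective fun r : Fin n =>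
      (outCopy (τ r) : (Fin n ⊕ Fin 1) ⊕ (Fin n ⊕ Fin 1)) := fun r s h' => h.inj (by simpa using h')
  constructor
  · rintro ⟨M', hM', hcard, C, hC, hnz, hdef⟩
    obtain ⟨s, rfl⟩ := (h.isComponent_iff C).1 hC
    refine ⟨s, ?_, hnz⟩
    by_contra hnr
    rw [h.ncard_outCopy] at hdef
    obtain ⟨ρ, hρ, hstep, rfl⟩ := (hM'.isPathCycleFamily.isLinking.ncard_le_and_exists hinjIn
      h.splitGraph_delete_adj_iff).2 (by rw [hcard, ncard_compl_singleton_fin])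
    let K := stepClass A b τ s
    -- If `i` does not reach `s`, then `ρ` is injective on the ancestors of `s` and maps those
    -- outside `K` into themselves, hence onto themselves. So `ρ` keeps `K` inside `K`, and the
    -- family has all `K.ncard` edges in the component.
    let U' : Set (Fin n) := {r | Relation.ReflTransGen (Step A b τ) r s ∧ r ∉ K}
    have hUi : ∀ r, Relation.ReflTransGen (Step A b τ) r s → r ∈ ({i}ᶜ : Set (Fin n)) := by
      rintro r hr rfl
      exact hnr hr
    have hρU : ∀ r, Relation.ReflTransGen (Step A b τ) r s →
        Relation.ReflTransGen (Step A b τ) (ρ r) s := fun r hr => (hr.head (hstep r (hUi r hr)))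
    have hmaps : ρ '' U' ⊆ U' := by
      rintro _ ⟨r, ⟨hr, hrK⟩, rfl⟩
      exact ⟨hρU r hr, fun hK => hrK ⟨hK.1.tail (hstep r (hUi r hr)), hr⟩⟩
    have hUeq : ρ '' U' = U' := Set.eq_of_subset_of_ncard_le hmaps (by
      rw [Set.InjOn.ncard_image (hρ.mono fun r hr => hUi r hr.1)])
    have hKK : ∀ r ∈ K, ρ r ∈ K := by
      intro r hr
      by_contra hn
      obtain ⟨q, hq, hqr⟩ : ρ r ∈ ρ '' U' := hUeq.symm ▸ ⟨hρU r hr.2, hn⟩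
      exact hq.2 (hρ (hUi q hq.1) (hUi r hr.2) hqr ▸ hr)
    have hsub : (fun r => (outCopy (τ (ρ r)), inCopy (Sum.inl r))) '' K ⊆
        (fun r => ((outCopy (τ (ρ r)), inCopy (Sum.inl r)) :
          ((Fin n ⊕ Fin 1) ⊕ (Fin n ⊕ Fin 1)) × ((Fin n ⊕ Fin 1) ⊕ (Fin n ⊕ Fin 1)))) '' {i}ᶜ ∩
          inducedEdges (splitGraph A b) (splitClass τ K) := by
      rintro _ ⟨r, hr, rfl⟩
      exact ⟨⟨r, hUi r hr.2, rfl⟩, h.mem_inducedEdges_iff.2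
        ⟨ρ r, hKK r hr, r, hr, rfl, hstep r (hUi r hr.2)⟩⟩
    have h1 := Set.ncard_le_ncard hsub (Set.toFinite _)
    rw [Set.ncard_image_of_injective _ fun r s h' => hinjIn (congrArg Prod.snd h')] at h1
    exact absurd (hdef.trans h1) (Nat.not_succ_le_self _)
  · rintro ⟨s, hs, hnz⟩
    -- Shifting the transversal along a path from `i` to `s` frees row `i` and column `τ s`; the
    -- missing column makes the component deficient.
    obtain ⟨π, hπs, hπ⟩ := exists_perm_of_reflTransGen hs
    have hstep : ∀ r ∈ ({i}ᶜ : Set (Fin n)), Step A b τ (π.symm r) r := by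
      intro r hr
      have hne : π.symm r ≠ s := by
        rintro rfl
        exact hr (by simpa using hπs)
      rcases hπ _ hne with h1 | h1
      · rw [Equiv.apply_symm_apply] at h1
        have h2 : τ (π.symm r) = τ r := congrArg τ h1.symm
        unfold Step
        rw [h2]
        exact h.entry r
      · rwa [Equiv.apply_symm_apply] at h1
    obtain ⟨h2, h3⟩ := isLinking_image hinjOut hinjIn h.splitGraph_delete_adj_iff
      (ρ := π.symm) (π.symm.injective.injOn) hstep
    refine ⟨_, (isPathFamily_splitGraph_iff _ _ _ _).2 h2, by rw [h3, ncard_compl_singleton_fin],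
      _, (h.isComponent_iff _).2 ⟨s, rfl⟩, hnz, ?_⟩
    rw [h.ncard_outCopy]
    set K := stepClass A b τ s with hK
    have hsK : s ∈ K := ⟨Relation.ReflTransGen.refl, Relation.ReflTransGen.refl⟩
    rw [Nat.succ_le_iff, ← Set.ncard_image_of_injective K hinjOut]
    have hinj : Set.InjOn Prod.fst ((fun r => ((outCopy (τ (π.symm r)), inCopy (Sum.inl r)) :
          ((Fin n ⊕ Fin 1) ⊕ (Fin n ⊕ Fin 1)) × ((Fin n ⊕ Fin 1) ⊕ (Fin n ⊕ Fin 1)))) '' {i}ᶜ ∩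
          inducedEdges (splitGraph A b) (splitClass τ K)) :=
      h2.injFst.mono Set.inter_subset_left
    rw [← Set.InjOn.ncard_image hinj]
    refine Set.ncard_lt_ncard (Set.ssubset_iff_of_subset ?_ |>.2 ⟨outCopy (τ s), ⟨s, hsK, rfl⟩, ?_⟩)
      (Set.toFinite _)
    · rintro _ ⟨e, ⟨-, he⟩, rfl⟩
      obtain ⟨q, hq, r, -, rfl, -⟩ := h.mem_inducedEdges_iff.1 he
      exact ⟨q, hq, rfl⟩
    · rintro ⟨_, ⟨⟨r, hr, rfl⟩, -⟩, he⟩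
      have h4 : π.symm r = s := hinjOut he
      apply hr
      rw [← h4] at hπs
      simpa using hπs

/-- A left null vector at a nonzero eigenvalue yields a singular diagonal block reachable
from `i`. -/
theorem exists_det_diagBlock_eq_zero {c : ℂ} {t : FreeEntry (hcat A b) → ℂ} {w : Fin n → ℂ}
    (hw : w ᵥ* reducedPencil A b τ c t = 0) (hwi : w i ≠ 0) :
    ∃ s, Relation.ReflTransGen (Step A b τ) i s ∧
      (diagBlock (stepClass A b τ s) (reducedPencil A b τ c t)).det = 0 := by
  classical
  let desc : Fin n → Set (Fin n) := fun s => {r | Relation.ReflTransGen (Step A b τ) s r}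
  -- Among the rows reachable from `i` in the support of `w`, one with fewest descendants has `w =
  -- 0` on all descendants outside its class. Hence `w` restricted to the class is a null vector of
  -- the block.
  obtain ⟨s, ⟨his, hws⟩, hmin⟩ := Set.exists_min_image
    {s | Relation.ReflTransGen (Step A b τ) i s ∧ w s ≠ 0} (fun s => (desc s).ncard)
    (Set.toFinite _) ⟨i, Relation.ReflTransGen.refl, hwi⟩
  refine ⟨s, his, ?_⟩
  set K := stepClass A b τ s with hK
  have hzero : ∀ r, Relation.ReflTransGen (Step A b τ) s r → r ∉ K → w r = 0 := by
    intro r hr hrK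
    by_contra hne
    have h1 := hmin r ⟨his.trans hr, hne⟩
    refine absurd h1 (not_le.2 (Set.ncard_lt_ncard ?_ (Set.toFinite _)))
    refine (Set.ssubset_iff_of_subset fun q hq => hr.trans hq).2
      ⟨s, Relation.ReflTransGen.refl, fun h2 => hrK ⟨hr, h2⟩⟩
  rw [← Matrix.exists_vecMul_eq_zero_iff]
  have hsK : s ∈ K := ⟨Relation.ReflTransGen.refl, Relation.ReflTransGen.refl⟩
  refine ⟨fun r => if r ∈ K then w r else 0, fun h0 => hws ?_, ?_⟩
  · simpa [hsK] using congrFun h0 s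
  · ext q
    change ∑ r, (if r ∈ K then w r else 0) * diagBlock K (reducedPencil A b τ c t) r q = 0
    by_cases hq : q ∈ K
    · refine Eq.trans (Finset.sum_congr rfl fun r _ => ?_) (congrFun hw q)
      by_cases hr : r ∈ K
      · rw [if_pos hr, diagBlock_apply_mem hr hq]
      · rw [if_neg hr, zero_mul]
        by_cases hqr : Step A b τ q r
        · rw [hzero r (hq.1.tail hqr) hr, zero_mul]
        · exact (mul_eq_zero_of_right _ (reducedPencil_eq_zero hqr c t)).symm
    · refine Finset.sum_eq_zero fun r _ => ?_
      by_cases hr : r ∈ K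
      · rw [diagBlock_apply_notMem fun h => hq h.2, if_neg (fun h : r = q => hq (h ▸ hr)),
          mul_zero]
      · rw [if_neg hr, zero_mul]

/-- If the reduced pencil of a controllable realization has a left null vector that does not
vanish at `i`, then some cofactor of row `i` does not vanish. -/
theorem exists_adjugate_ne_zero (h : IsTransversal A b j τ) {c : ℂ}
    {t : FreeEntry (hcat A b) → ℂ} (hc : Controllable (realize (hcat A b) t)) {w : Fin n → ℂ}
    (hw : w ᵥ* reducedPencil A b τ c t = 0) (hwi : w i ≠ 0) :
    ∃ l, (reducedPencil A b τ c t).adjugate l i ≠ 0 := by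
  have hdet : (reducedPencil A b τ c t).det = 0 :=
    Matrix.exists_vecMul_eq_zero_iff.1 ⟨w, fun h0 => hwi (congrFun h0 i), hw⟩
  obtain ⟨z, hz0, hz⟩ := Matrix.exists_mulVec_eq_zero_iff.2 hdet
  obtain ⟨l, hl⟩ := Function.ne_iff.1 hz0
  refine ⟨l, adjugate_ne_zero_of_kernels (fun v hv hvi => ?_) hz hl⟩
  let P : Fin n → Fin n ⊕ Fin 1 → ℂ := fun r u =>
    realize (hcat A b) t r u - if u = Sum.inl r then c else 0
  have hpbh : ∀ x : Fin n → ℂ, (∀ u, ∑ r, x r * P r u = 0) → x = 0 :=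
    (controllable_iff_pbh _).1 hc c
  have hcol : ∀ x : Fin n → ℂ, x ᵥ* reducedPencil A b τ c t = 0 → ∀ u, u ≠ j →
      ∑ r, x r * P r u = 0 := by
    intro x hx u hu
    obtain ⟨s, rfl⟩ := h.surj hu
    exact congrFun hx s
  let α := ∑ r, w r * P r j
  let β := ∑ r, v r * P r j
  -- This combination also annihilates column `j`, so controllability makes it zero. Reading it at
  -- `i`, where `v` vanishes, gives `β = 0`, so `v` itself annihilates the whole pencil.
  have hcomb : (fun r => α * v r - β * w r) = 0 := by
    refine hpbh _ fun u => ?_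
    have h1 : ∑ r, (α * v r - β * w r) * P r u =
        α * ∑ r, v r * P r u - β * ∑ r, w r * P r u := by
      rw [Finset.mul_sum, Finset.mul_sum, ← Finset.sum_sub_distrib]
      exact Finset.sum_congr rfl fun r _ => by ring
    rw [h1]
    by_cases hu : u = j
    · subst hu; simp only [α, β]; ring
    · rw [hcol v hv u hu, hcol w hw u hu]; ring
  have hβ : β = 0 := by
    have := congrFun hcomb i
    simp only [hvi, mul_zero, zero_sub, Pi.zero_apply, neg_eq_zero] at this
    exact (mul_eq_zero.1 this).resolve_right hwi
  refine hpbh v fun u => ?_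
  by_cases hu : u = j
  · subst hu; exact hβ
  · exact hcol v hv u hu

/-- A null vector at `c = 0` gives a singular matrix, excluding a full matching generically, and a
nonzero cofactor of row `i`, hence a matching of the other rows. At `c ≠ 0`, a singular block
reachable from `i` generically requires `GammaNz`, because otherwise its determinant is a nonzero
multiple of a power of `c`. -/
theorem ptsc_of_not (h : IsTransversal A b j τ) (hF : ∀ k l, F k l = true ↔ k = i ∧ l = j)
    (ha : ¬ ((¬ ∃ π : Equiv.Perm (Fin n), ∀ s, hcat A b (π s) (τ s) = true) ∧
        ∃ ρ : Fin n → Fin n, Set.InjOn ρ {i}ᶜ ∧ ∀ r ∈ ({i}ᶜ : Set (Fin n)),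
          hcat A b r (τ (ρ r)) = true))
    (hb : ¬ ∃ s, Relation.ReflTransGen (Step A b τ) i s ∧
        GammaNz A b (splitClass τ (stepClass A b τ s))) : PTSC A b F := by
  classical
  have hae : ∀ᵐ t : FreeEntry (hcat A b) → ℂ, ∀ s,
      ¬ GammaNz A b (splitClass τ (stepClass A b τ s)) →
        (diagBlock (stepClass A b τ s) (reducedPencil A b τ 1 t)).det ≠ 0 := by
    rw [ae_all_iff]
    intro s
    by_cases hs : GammaNz A b (splitClass τ (stepClass A b τ s))
    · exact Filter.Eventually.of_forall fun t h1 => absurd hs h1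
    · filter_upwards [ae_det_diagBlock_ne_zero h hs] with t ht _ using ht
  have hae0 : ∀ᵐ t : FreeEntry (hcat A b) → ℂ,
      (∃ π : Equiv.Perm (Fin n), ∀ s, hcat A b (π s) (τ s) = true) →
        (reducedPencil A b τ 0 t).det ≠ 0 := by
    by_cases hs : ∃ π : Equiv.Perm (Fin n), ∀ s, hcat A b (π s) (τ s) = true
    · obtain ⟨π, hπ⟩ := hs
      filter_upwards [ae_det_reducedPencil_zero_ne_zero h hπ] with t ht _ using ht
    · exact Filter.Eventually.of_forall fun t h1 => absurd h1 hs
  filter_upwards [hae, hae0] with t h1 h2 hc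
  by_contra hp
  obtain ⟨c, w, hw, hwi⟩ := (not_ptc_iff h hF hc).1 hp
  by_cases hc0 : c = 0
  · subst hc0
    refine ha ⟨fun hπ => h2 hπ (Matrix.exists_vecMul_eq_zero_iff.1
      ⟨w, fun h0 => hwi (congrFun h0 i), hw⟩), ?_⟩
    obtain ⟨l, hl⟩ := exists_adjugate_ne_zero h hc hw hwi
    rw [Matrix.adjugate_apply] at hl
    obtain ⟨π, hπ⟩ := exists_perm_of_det_ne_zero hl
    refine ⟨π.symm, π.symm.injective.injOn, fun r hr => ?_⟩
    have h3 := hπ (π.symm r)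
    rw [Equiv.apply_symm_apply, Matrix.updateRow_ne hr] at h3
    by_contra h4
    exact h3 (by simp [reducedPencil, realize_of_false h4])
  · obtain ⟨s, his, hdet⟩ := exists_det_diagBlock_eq_zero hw hwi
    by_cases hnz : GammaNz A b (splitClass τ (stepClass A b τ s))
    · exact hb ⟨s, his, hnz⟩
    · rw [det_diagBlock_eq h hnz] at hdet
      exact h1 s hnz ((mul_eq_zero.1 hdet).resolve_left (pow_ne_zero _ hc0))

theorem continuous_realize {p q : Type} (S : StructuredMatrix p q) (r : p) (u : q) :
    Continuous fun t => realize S t r u := by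
  by_cases h : S r u = true
  · simpa [realize, h] using continuous_apply (⟨(r, u), h⟩ : FreeEntry S)
  · simpa [realize, h] using continuous_const

theorem continuous_reducedPencil :
    Continuous fun p : ℂ × (FreeEntry (hcat A b) → ℂ) => reducedPencil A b τ p.1 p.2 := by
  refine continuous_matrix fun r s => ?_
  refine ((continuous_realize _ _ _).comp continuous_snd).sub ?_
  split_ifs
  · exact continuous_fst
  · exact continuous_const

/-- Without a full matching the determinant at `c = 0` vanishes for all parameters, so each adjugate
row is a left null vector. Its `i`-th entry is nonzero at the indicator of the partial matching,
hence near it. -/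
theorem not_ptsc_of_rank_deficient (h : IsTransversal A b j τ)
    (hF : ∀ k l, F k l = true ↔ k = i ∧ l = j) (hsc : StructurallyControllable A b)
    (hno : ¬ ∃ π : Equiv.Perm (Fin n), ∀ s, hcat A b (π s) (τ s) = true)
    {ρ : Fin n → Fin n} (hinj : Set.InjOn ρ {i}ᶜ)
    (hρ : ∀ r ∈ ({i}ᶜ : Set (Fin n)), hcat A b r (τ (ρ r)) = true) : ¬ PTSC A b F := by
  classical
  have hdet : ∀ t, (reducedPencil A b τ 0 t).det = 0 := by
    intro t
    by_contra hne
    obtain ⟨π, hπ⟩ := exists_perm_of_det_ne_zero hne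
    refine hno ⟨π, fun s => ?_⟩
    by_contra h1
    exact hπ s (by simp [reducedPencil, realize_of_false h1])
  obtain ⟨l, hl⟩ : ∃ l, l ∉ ρ '' {i}ᶜ := by
    by_contra! hall
    have h1 : ρ '' {i}ᶜ = Set.univ := Set.eq_univ_of_forall hall
    have h2 := Set.InjOn.ncard_image hinj
    rw [h1, ncard_compl_singleton_fin, Set.ncard_univ, Nat.card_eq_fintype_card,
      Fintype.card_fin] at h2
    have := i.pos
    omega
  -- The column `l` missed by `ρ` goes to row `i`, completing `ρ` to a permutation.
  let g : Fin n → Fin n := fun r => if r = i then l else ρ r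
  have hgi : g i = l := if_pos rfl
  have hg : ∀ r, r ≠ i → g r = ρ r := fun r hr => if_neg hr
  have hginj : Function.Injective g := by
    intro r s hrs
    by_cases hr : r = i <;> by_cases hs : s = i
    · rw [hr, hs]
    · rw [hr, hgi, hg s hs] at hrs
      exact absurd ⟨s, hs, hrs.symm⟩ hl
    · rw [hs, hgi, hg r hr] at hrs
      exact absurd ⟨r, hr, hrs⟩ hl
    · rw [hg r hr, hg s hs] at hrs
      exact hinj hr hs hrs
  let π : Equiv.Perm (Fin n) := Equiv.ofBijective g (Finite.injective_iff_bijective.1 hginj)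
  let t₀ : FreeEntry (hcat A b) → ℂ := fun e => if ∃ r, r ≠ i ∧ e.1 = (r, τ (ρ r)) then 1 else 0
  have hadj₀ : (reducedPencil A b τ 0 t₀).adjugate l i ≠ 0 := by
    rw [Matrix.adjugate_apply]
    have hentry : ∀ r s, r ≠ i → (s = ρ r → reducedPencil A b τ 0 t₀ r s ≠ 0) ∧
        (reducedPencil A b τ 0 t₀ r s ≠ 0 → s = ρ r) := by
      intro r s hr
      constructor
      · rintro rfl
        simp only [reducedPencil, Matrix.of_apply, ite_self, sub_zero,
          realize_of_true (hρ r hr), t₀]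
        rw [if_pos ⟨r, hr, rfl⟩]
        exact one_ne_zero
      · intro hne
        by_contra hs
        refine hne ?_
        by_cases h2 : hcat A b r (τ s) = true
        · simp only [reducedPencil, Matrix.of_apply, ite_self, sub_zero, realize_of_true h2, t₀]
          rw [if_neg]
          rintro ⟨q, -, hq⟩
          rw [Prod.mk.injEq] at hq
          exact hs (by rw [hq.1]; exact h.inj hq.2)
        · simp [reducedPencil, realize_of_false h2]
    refine det_ne_zero_of_unique_perm π.symm (fun s => ?_) fun σ hσ => ?_
    · obtain ⟨r, rfl⟩ := π.surjective s
      rw [Equiv.symm_apply_apply]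
      change (reducedPencil A b τ 0 t₀).updateRow i (Pi.single l 1) r (g r) ≠ 0
      by_cases hr : r = i
      · rw [hr, hgi, Matrix.updateRow_self]; simp
      · rw [hg r hr, Matrix.updateRow_ne hr]
        exact (hentry r _ hr).1 rfl
    · ext s : 1
      rw [Equiv.eq_symm_apply]
      change g (σ s) = s
      have h1 := hσ s
      by_cases hr : σ s = i
      · rw [hr, hgi]
        rw [hr, Matrix.updateRow_self] at h1
        by_contra hne
        exact h1 (by rw [Pi.single_apply, if_neg (fun h => hne h.symm)])
      · rw [hg _ hr]
        rw [Matrix.updateRow_ne hr] at h1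
        exact ((hentry _ _ hr).2 h1).symm
  have hcont : Continuous fun t => (reducedPencil A b τ 0 t).adjugate l i := by
    have h1 : Continuous fun t => reducedPencil A b τ 0 t :=
      continuous_reducedPencil.comp (Continuous.prodMk_right 0)
    exact h1.matrix_adjugate.matrix_elem l i
  refine not_ptsc_of_eventually h hF hsc (t₀ := t₀) ?_
  filter_upwards [hcont.continuousAt.eventually_ne hadj₀] with t ht
  refine ⟨0, (reducedPencil A b τ 0 t).adjugate l, ?_, ht⟩
  ext s
  have := congrFun (congrFun (Matrix.adjugate_mul (reducedPencil A b τ 0 t)) l) s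
  rw [hdet t, zero_smul] at this
  exact this

end StructControl

/-! ### Sufficiency of a reachable class with nonzero modes. -/

namespace StructControl

open scoped Matrix

variable {n : ℕ} {A : StructuredMatrix (Fin n) (Fin n)} {b : StructuredMatrix (Fin n) (Fin 1)}
  {F : StructuredMatrix (Fin n) (Fin n ⊕ Fin 1)} {i : Fin n}
  {j : Fin n ⊕ Fin 1} {τ : Fin n → Fin n ⊕ Fin 1}

/-- Only the rows `U` that reach `s₀` matter: a left null vector of their block extends by zero. The
Laplacian realization has a zero of the block determinant at `c = 1` with nonzero cofactor at `i`,
and both survive for nearby parameters. -/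
theorem not_ptsc_of_gammaNz (h : IsTransversal A b j τ)
    (hF : ∀ k l, F k l = true ↔ k = i ∧ l = j) (hsc : StructurallyControllable A b) {s₀ : Fin n}
    (his : Relation.ReflTransGen (Step A b τ) i s₀)
    (hnz : GammaNz A b (splitClass τ (stepClass A b τ s₀))) : ¬ PTSC A b F := by
  classical
  let U : Fin n → Prop := fun r => Relation.ReflTransGen (Step A b τ) r s₀
  let D : Type := {r : Fin n // U r}
  let H : D → D → Prop := fun s r => Step A b τ s.1 r.1
  let lam : D → D → Prop := fun s r => τ s.1 = Sum.inl r.1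
  let free : D → D → Prop := fun s r => hcat A b r.1 (τ s.1) = true
  let d₀ : D := ⟨s₀, Relation.ReflTransGen.refl⟩
  have hreach : ∀ s : D, Relation.ReflTransGen H s d₀ := by
    rintro ⟨s, hs⟩
    induction hs using Relation.ReflTransGen.head_induction_on with
    | refl => exact Relation.ReflTransGen.refl
    | head hst hts ih => exact Relation.ReflTransGen.head (show H ⟨_, _⟩ ⟨_, hts⟩ from hst) ih
  have hclass : ∀ s : D, Relation.ReflTransGen H d₀ s ↔ s.1 ∈ stepClass A b τ s₀ := by
    rintro ⟨s, hs⟩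
    constructor
    · intro h1
      exact ⟨h1.lift Subtype.val fun _ _ h2 => h2, hs⟩
    · rintro ⟨h1, -⟩
      change Relation.ReflTransGen (Step A b τ) s₀ s at h1
      induction h1 with
      | refl => exact Relation.ReflTransGen.refl
      | @tail p q h2 h3 ih =>
        exact (ih (Relation.ReflTransGen.head h3 hs)).tail h3
  have hsingular : (∃ π : Equiv.Perm D, (∀ s, H s (π s)) ∧
        {s | Relation.ReflTransGen H d₀ s ∧ lam s (π s)}.ncard ≠
          {s | Relation.ReflTransGen H d₀ s ∧ lam s s}.ncard) ∨
      ∃ s r, Relation.ReflTransGen H d₀ s ∧ lam s r ∧ free s r := by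
    rcases h.gammaNz_iff.1 hnz with ⟨π, hπ, hne⟩ | ⟨s, hs, r, hr, hl, hA⟩
    · left
      have hiff : ∀ x, U (π x) ↔ U x := by
        intro x
        by_cases hx : x ∈ stepClass A b τ s₀
        · exact ⟨fun _ => hx.2, fun _ => (hπ.mem x hx).2⟩
        · rw [hπ.fix x hx]
      have hcount : ∀ σ : Fin n → Fin n, ∀ σ' : D → D, (∀ s, (σ' s).1 = σ s.1) →
          {s | Relation.ReflTransGen H d₀ s ∧ lam s (σ' s)}.ncard =
            {s | s ∈ stepClass A b τ s₀ ∧ τ s = Sum.inl (σ s)}.ncard := by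
        intro σ σ' hσ
        rw [← Set.ncard_image_of_injective _ (Subtype.val_injective (p := U))]
        congr 1
        ext s
        constructor
        · rintro ⟨d, ⟨h1, h2⟩, rfl⟩
          exact ⟨(hclass d).1 h1, by rw [← hσ]; exact h2⟩
        · rintro ⟨h1, h2⟩
          exact ⟨⟨s, h1.2⟩, ⟨(hclass _).2 h1, by change τ s = _; rw [hσ]; exact h2⟩, rfl⟩
      refine ⟨π.subtypePerm hiff, fun s => ?_, ?_⟩
      · by_cases hs : s.1 ∈ stepClass A b τ s₀
        · exact hπ.step s.1 hs
        · change Step A b τ s.1 (π s.1)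
          rw [hπ.fix _ hs]
          exact h.entry _
      · rw [hcount π _ fun s => rfl, hcount (fun s => s) (fun s => s) fun s => rfl]
        exact hne
    · right
      refine ⟨⟨s, hs.2⟩, ⟨r, hr.2⟩, (hclass _).2 hs, hl, ?_⟩
      change hcat A b r (τ s) = true
      rw [hl]; exact hA
  obtain ⟨Z, hZ0, hZlam, hZdet, hZadj, c₁, hc₁⟩ := exists_singular_realization (H := H) (lam := lam)
    (free := free) (fun s => h.entry s.1) (fun s r hsr => Or.inr hsr)
    (fun s r r' h1 h2 => Subtype.ext (Sum.inl_injective (h1.symm.trans h2))) hreach hsingular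
  let J : Matrix D D ℂ := Matrix.of fun r s => if lam s r then (1 : ℂ) else 0
  let pos : D × D → Fin n × (Fin n ⊕ Fin 1) := fun p => (p.1.1, τ p.2.1)
  have hpos : Function.Injective pos := by
    rintro ⟨r, s⟩ ⟨r', s'⟩ h1
    rw [Prod.mk.injEq] at h1
    exact Prod.ext (Subtype.ext h1.1) (Subtype.ext (h.inj h1.2))
  -- The summand `1` on free `λ`-entries compensates the `-c` of the pencil at `c = 1`. The value
  -- `0` at the remaining positions is arbitrary, since the block on `D` does not see them.
  let t₀ : FreeEntry (hcat A b) → ℂ := fun e =>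
    Function.extend pos (fun p => Z p.1 p.2 + if lam p.2 p.1 then 1 else 0) 0 e.1
  have ht₀ : ∀ (r s : D) (hf : free s r), t₀ ⟨(r.1, τ s.1), hf⟩ =
      Z r s + if lam s r then 1 else 0 := fun r s _ => hpos.extend_apply _ _ (r, s)
  let Q : ℂ × (FreeEntry (hcat A b) → ℂ) → Matrix D D ℂ := fun p =>
    (reducedPencil A b τ p.1 p.2).submatrix Subtype.val Subtype.val
  have hQ : ∀ c, Q (c, t₀) = Z - (c - 1) • J := by
    intro c
    ext r s
    change realize (hcat A b) t₀ r.1 (τ s.1) - (if lam s r then c else 0) =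
      Z r s - (c - 1) * (if lam s r then (1 : ℂ) else 0)
    by_cases hf : free s r
    · rw [realize_of_true hf, ht₀ r s hf]
      split_ifs <;> ring
    · rw [realize_of_false hf]
      by_cases hl : lam s r
      · rw [hZlam s r hl hf, if_pos hl, if_pos hl]; ring
      · rw [hZ0 s r (fun h1 => h1.elim hf hl), if_neg hl, if_neg hl]; ring
  have hQcont : Continuous Q := continuous_reducedPencil.matrix_submatrix _ _
  have hdiff : ∀ t, Differentiable ℂ fun c => (Q (c, t)).det := by
    intro t
    simp only [Matrix.det_apply']
    refine Differentiable.fun_sum fun π _ => (differentiable_const _).mul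
      (Differentiable.fun_finsetProd fun s _ => ?_)
    change Differentiable ℂ fun c => realize (hcat A b) t (π s).1 (τ s.1) -
      (if τ s.1 = Sum.inl (π s).1 then c else 0)
    split_ifs <;> fun_prop
  have hev := eventually_exists_zero (f := fun p => (Q p).det)
    (g := fun p => (Q p).adjugate d₀ ⟨i, his⟩) hQcont.matrix_det
    (hQcont.matrix_adjugate.matrix_elem _ _) hdiff (c₀ := 1) (t₀ := t₀)
    (by simp only [hQ, sub_self, zero_smul, sub_zero]; exact hZdet)
    (by simp only [hQ, sub_self, zero_smul, sub_zero]; exact hZadj _)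
    ⟨1 + c₁, by simp only [hQ, add_sub_cancel_left]; exact hc₁⟩
  refine not_ptsc_of_eventually h hF hsc (t₀ := t₀) ?_
  filter_upwards [hev] with t ht
  obtain ⟨c, hdet, hadj⟩ := ht
  let y : D → ℂ := (Q (c, t)).adjugate d₀
  have hy : y ᵥ* Q (c, t) = 0 := by
    ext s
    have := congrFun (congrFun (Matrix.adjugate_mul (Q (c, t))) d₀) s
    rw [show (Q (c, t)).det = 0 from hdet, zero_smul] at this
    exact this
  refine ⟨c, fun r => if hr : U r then y ⟨r, hr⟩ else 0, ?_, ?_⟩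
  · ext s
    change ∑ r, (if hr : U r then y ⟨r, hr⟩ else 0) * reducedPencil A b τ c t r s = 0
    by_cases hs : U s
    · have h1 : ∑ r : D, y r * reducedPencil A b τ c t r.1 s = 0 := congrFun hy ⟨s, hs⟩
      have h2 : ∑ r : {r // ¬ U r}, (if hr : U r then y ⟨r, hr⟩ else 0) *
          reducedPencil A b τ c t r s = 0 :=
        Finset.sum_eq_zero fun r _ => mul_eq_zero_of_left (dif_neg r.2) _
      rw [← Fintype.sum_subtype_add_sum_subtype U, h2, add_zero, ← h1]
      exact Finset.sum_congr rfl fun r _ => by rw [dif_pos r.2]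
    · refine Finset.sum_eq_zero fun r _ => ?_
      by_cases hr : U r
      -- A nonzero entry in a row of `U` puts its column in `U` too, so columns outside `U` vanish
      -- on the support.
      · exact mul_eq_zero_of_right _ (reducedPencil_eq_zero (fun h1 => hs (hr.head h1)) c t)
      · rw [dif_neg hr, zero_mul]
  · change (if hr : U i then y ⟨i, hr⟩ else 0) ≠ 0
    rw [dif_pos (show U i from his)]
    exact hadj

end StructControl

theorem mainTheorem9 {n : ℕ} (A : StructuredMatrix (Fin n) (Fin n))
    (b : StructuredMatrix (Fin n) (Fin 1)) (F : StructuredMatrix (Fin n) (Fin n ⊕ Fin 1))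
    (i : Fin n) (j : Fin n ⊕ Fin 1)
    (hF : ∀ k l, F k l = true ↔ k = i ∧ l = j)
    (hsc : StructurallyControllable A b) :
    (∃ M, IsPathFamily (deleteEdges (splitGraph A b) (outEdges (splitGraph A b) (outCopy j))) M ∧
      M.ncard = n) ∧
    ∀ M, IsPathFamily (deleteEdges (splitGraph A b) (outEdges (splitGraph A b) (outCopy j))) M →
      M.ncard = n →
      (PSSC A b F ↔
        (IsMaxPathCycleFamilySize
            (deleteEdges (systemGraph A b) (outEdges (systemGraph A b) j)) (n - 1) ∧
          IsMaxPathCycleFamilySize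
            (deleteEdges (systemGraph A b)
              (outEdges (systemGraph A b) j ∪ inEdges (systemGraph A b) (Sum.inl i))) (n - 1)) ∨
        (∃ M', IsPathFamily
            (deleteEdges (splitGraph A b)
              (outEdges (splitGraph A b) (outCopy j) ∪
                inEdges (splitGraph A b) (inCopy (Sum.inl i)))) M' ∧
          M'.ncard = n - 1 ∧
          ∃ C, IsComponent A b j M C ∧ GammaNz A b C ∧
            (M' ∩ inducedEdges (splitGraph A b) C).ncard + 1 ≤
              {u : Fin n ⊕ Fin 1 | outCopy u ∈ C}.ncard)) := by
  refine ⟨exists_pathFamily_of_structurallyControllable hsc j, fun M hM hn => ?_⟩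
  obtain ⟨τ, hτ, rfl⟩ := exists_transversal hM hn
  rw [hτ.maxPathCycle_iff, hτ.exists_deficient_pathFamily_iff]
  constructor
  · rintro ⟨-, hp⟩
    by_contra hno
    rw [not_or] at hno
    exact hp (ptsc_of_not hτ hF hno.1 hno.2)
  · rintro (⟨hno, ρ, hinj, hρ⟩ | ⟨s, his, hnz⟩)
    · exact ⟨hsc, not_ptsc_of_rank_deficient hτ hF hsc hno hinj hρ⟩
    · exact ⟨hsc, not_ptsc_of_gammaNz hτ hF hsc his hnz⟩
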